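/- Let $G$ be a (finite-dimensional, real, smooth) Lie group with Lie algebra $\mathfrak g$, let $H\subset G$ be a compact connected Lie subgroup with Lie algebra $\mathfrak h\subset\mathfrak g$ and normalised Haar measure $dh$, and let $\langle\cdot,\cdot\rangle$ be an $\mathrm{Ad}_H$-invariant inner product on $\mathfrak g$. Put $\mathfrak m=\mathfrak h^\perp$, and let $\mathfrak m=\mathfrak m_0\oplus\mathfrak m_1\oplus\dots\oplus\mathfrak m_r$ be an orthogonal decomposition into $\mathrm{Ad}_H$-invariant subspaces, where $\mathfrak m_0$ is the space of $\mathrm{Ad}_H$-fixed vectors of $\mathfrak m$ and $\mathfrak m_j$ is irreducible for $j\neq0$. Write $L_{X}$ for differentiation along the left-invariant vector field generated by a Lie algebra element $X$, and, for a subspace $\mathfrak n\subset\mathfrak g$ with orthonormal basis $\{W_i\}$, put $\Delta_{\mathfrak n}=\sum_i L_{W_i}L_{W_i}$. Let $A_1,\dots,A_N\in\mathfrak h$ be such that they and their iterated brackets span $\mathfrak h$, and let $\mathcal L_0=\frac12\sum_{k=1}^N (A_k)^2$, acting on functions on $H$. Let $Y_0\in\mathfrak m_l$ with $l\neq0$.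 Let $\mathfrak m_l\subset\tilde{\mathfrak m}\subset\mathfrak m$ be an $\mathrm{Ad}_H$-invariant subspace (for example $\tilde{\mathfrak m}=\mathfrak m_l$) and $\{Z_j\}$ an orthonormal basis of $\tilde{\mathfrak m}$; set $\alpha_j(h)=\langle \mathrm{Ad}(h)Y_0,Z_j\rangle$ for $h\in H$. Then each Poisson equation $\mathcal L_0u=\alpha_j$ has a solution $u\in C^\infty(H)$. For any choice of smooth solutions, denoted $\mathcal L_0^{-1}\alpha_j$, define the effective generator $$\bar{\mathcal L}=\sum_{i,j}a_{i,j}(Y_0)\,L_{Z_i}L_{Z_j},\qquad a_{i,j}(Y_0)=-\int_H\alpha_i\,\mathcal L_0^{-1}\alpha_j\,dh,$$ acting on $C^2(G;\mathbb R)$. Then the following hold. 1. Let $\{Y_1,\dots,Y_d\}$ be any orthonormal basis of $\mathfrak m_l$ consisting of eigenvectors of $-\frac12\sum_{k}\mathrm{ad}^2(A_k)$, with eigenvalues $\lambda(Y_m)$, and write $Y_0=\sum_{m=1}^d c_mY_m$. Then all $\lambda(Y_m)>0$ and $$\bar{\mathcal L}=\frac1{\dim\mathfrak m_l}\sum_{m=1}^d\frac{c_m^2}{\lambda(Y_m)}\,\Delta_{\mathfrak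 m_l}.$$ 2. If furthermore $\{A_1,\dots,A_N\}$ is an orthonormal basis of $\mathfrak h$, then there is $\lambda_l>0$ with $-\frac12\sum_k\mathrm{ad}^2(A_k)|_{\mathfrak m_l}=\lambda_l\,\mathrm{Id}_{\mathfrak m_l}$, and $$\bar{\mathcal L}=\frac{|Y_0|^2}{\dim(\mathfrak m_l)\,\lambda_l}\,\Delta_{\mathfrak m_l}.$$ -/

import Mathlib

open scoped Manifold ContDiff
open MeasureTheory

namespace EffectiveLimit

noncomputable section

section Group

variable {n : ℕ} {G : Type*} [TopologicalSpace G] [Group G]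
  [ChartedSpace (EuclideanSpace ℝ (Fin n)) G]

/-- A smooth real Lie group has the regularity under which Mathlib endows its tangent space at the
identity with its Lie algebra structure. -/
instance instLieGroupMinSmoothness [LieGroup (𝓡 n) ∞ G] :
    LieGroup (𝓡 n) (minSmoothness ℝ 3) G :=
  LieGroup.of_le (n := ∞) (by
    rw [minSmoothness_of_isRCLikeNormedField]
    exact WithTop.coe_le_coe.mpr le_top)

/-- The derivative `L_{X^*} f` of a function along the left-invariant vector field `X^*`
generated by the Lie algebra element `X`. -/
def lieDeriv (X : GroupLieAlgebra (𝓡 n) G) (f : G → ℝ) (g : G) : ℝ :=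
  mfderiv (𝓡 n) 𝓘(ℝ, ℝ) f g (mulInvariantVectorField X g)

/-- The sum of squares `∑ i, L_{Y_i^*} L_{Y_i^*}`. If `Y` is an orthonormal basis of a subspace `V`
of the Lie algebra, this is the operator `Δ_V`. -/
def sumSquares {d : ℕ} (Y : Fin d → GroupLieAlgebra (𝓡 n) G) (f : G → ℝ) (g : G) : ℝ :=
  ∑ i, lieDeriv (Y i) (lieDeriv (Y i) f) g

variable (n) in
/-- The adjoint action `Ad g` on the Lie algebra: the differential at the identity of the
conjugation `x ↦ g x g⁻¹`, which maps the identity to itself. -/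
def Ad (g : G) : GroupLieAlgebra (𝓡 n) G →ₗ[ℝ] GroupLieAlgebra (𝓡 n) G :=
  (mfderiv (𝓡 n) (𝓡 n) (fun x : G => g * x * g⁻¹) 1).toLinearMap

/-- The linear map `-(1/2) ∑ k, ad²(A_k)` on the Lie algebra. -/
def casimir {N : ℕ} (A : Fin N → GroupLieAlgebra (𝓡 n) G) (X : GroupLieAlgebra (𝓡 n) G) :
    GroupLieAlgebra (𝓡 n) G :=
  -((1 / 2 : ℝ) • ∑ k, ⁅A k, ⁅A k, X⁆⁆)

/-- `Y` is a basis of the subspace `V`, orthonormal for the inner product `B`. -/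
structure IsOrthonormalBasisOf (B : LinearMap.BilinForm ℝ (GroupLieAlgebra (𝓡 n) G))
    (V : Submodule ℝ (GroupLieAlgebra (𝓡 n) G)) {d : ℕ}
    (Y : Fin d → GroupLieAlgebra (𝓡 n) G) : Prop where
  orthonormal : ∀ i j, B (Y i) (Y j) = if i = j then 1 else 0
  span_eq : Submodule.span ℝ (Set.range Y) = V

end Group

section Subgroup

variable {n p : ℕ} {G : Type*} [TopologicalSpace G] [Group G]
  [ChartedSpace (EuclideanSpace ℝ (Fin n)) G]
  (H : Subgroup G) [ChartedSpace (EuclideanSpace ℝ (Fin p)) H]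

variable (n p) in
/-- The inclusion of the Lie algebra of `H` into that of `G`: the differential at the identity of
the inclusion of `H` into `G`. -/
def inclLie : GroupLieAlgebra (𝓡 p) H →ₗ[ℝ] GroupLieAlgebra (𝓡 n) G :=
  (mfderiv (𝓡 p) (𝓡 n) (Subtype.val : H → G) 1).toLinearMap

variable (n p) in
/-- The Lie algebra `𝔥` of `H`, as a subspace of the Lie algebra of `G`. -/
def subLie : Submodule ℝ (GroupLieAlgebra (𝓡 n) G) :=
  LinearMap.range (inclLie n p H)

/-- `B` is an inner product on the Lie algebra of `G` which is invariant under `Ad h`, `h ∈ H`. -/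
structure IsInvariantInnerProduct
    (B : LinearMap.BilinForm ℝ (GroupLieAlgebra (𝓡 n) G)) : Prop where
  symm : ∀ X Y, B X Y = B Y X
  pos : ∀ X, X ≠ 0 → 0 < B X X
  invariant : ∀ h ∈ H, ∀ X Y, B (Ad n h X) (Ad n h Y) = B X Y

/-- The subspace `V` is invariant under `Ad h`, `h ∈ H`. -/
def IsAdInvariant (V : Submodule ℝ (GroupLieAlgebra (𝓡 n) G)) : Prop :=
  ∀ h ∈ H, ∀ X ∈ V, Ad n h X ∈ V

/-- The subspace `V` is an irreducible invariant subspace for the action of `Ad h`, `h ∈ H`. -/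
structure IsAdIrreducible (V : Submodule ℝ (GroupLieAlgebra (𝓡 n) G)) : Prop where
  invariant : IsAdInvariant H V
  ne_bot : V ≠ ⊥
  eq_bot_or_eq : ∀ W ≤ V, IsAdInvariant H W → W = ⊥ ∨ W = V

variable (p) in
/-- The orthogonal complement `𝔪 = 𝔥^⊥`. -/
def compl (B : LinearMap.BilinForm ℝ (GroupLieAlgebra (𝓡 n) G)) :
    Submodule ℝ (GroupLieAlgebra (𝓡 n) G) where
  carrier := {Y | ∀ X ∈ subLie n p H, B X Y = 0}
  add_mem' hX hY Z hZ := by rw [map_add, hX Z hZ, hY Z hZ, add_zero]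
  zero_mem' Z _ := map_zero (B Z)
  smul_mem' c X hX Z hZ := by rw [map_smul, hX Z hZ, smul_zero]

/-- `𝔪 = 𝔪₀ ⊕ 𝔪₁ ⊕ ⋯ ⊕ 𝔪ᵣ` is an orthogonal decomposition of `𝔪 = 𝔥^⊥` into `Ad H`-invariant
subspaces, where `𝔪₀` is the space of the `Ad H`-invariant vectors of `𝔪` and `𝔪ⱼ` is irreducible
for `j ≠ 0`. -/
structure IsIrreducibleDecomposition (p : ℕ) {G : Type*} [TopologicalSpace G] [Group G]
    [ChartedSpace (EuclideanSpace ℝ (Fin n)) G]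
    (H : Subgroup G) [ChartedSpace (EuclideanSpace ℝ (Fin p)) H]
    (B : LinearMap.BilinForm ℝ (GroupLieAlgebra (𝓡 n) G)) {r : ℕ}
    (𝔪 : Fin (r + 1) → Submodule ℝ (GroupLieAlgebra (𝓡 n) G)) : Prop where
  mem_zero_iff : ∀ X, X ∈ 𝔪 0 ↔ X ∈ compl p H B ∧ ∀ h ∈ H, Ad n h X = X
  irreducible : ∀ j, j ≠ 0 → IsAdIrreducible H (𝔪 j)
  orthogonal : ∀ i j, i ≠ j → ∀ X ∈ 𝔪 i, ∀ Y ∈ 𝔪 j, B X Y = 0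
  iSup_eq : ⨆ j, 𝔪 j = compl p H B

/-- The family `A` of elements of `𝔥` and their iterated brackets span `𝔥`. -/
def IsLieGenerating [LieGroup (𝓡 n) ∞ G] {N : ℕ} (A : Fin N → GroupLieAlgebra (𝓡 p) H) : Prop :=
  ∀ X : GroupLieAlgebra (𝓡 n) G,
    X ∈ LieSubalgebra.lieSpan ℝ (GroupLieAlgebra (𝓡 n) G)
      (Set.range fun k => inclLie n p H (A k)) ↔ X ∈ subLie n p H

/-- `u` is a smooth solution on `H` of the Poisson equation `𝓛₀ u = α`, where
`𝓛₀ = (1/2) ∑ k, (A_k)²`. -/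
structure IsPoissonSolution {N : ℕ} (A : Fin N → GroupLieAlgebra (𝓡 p) H) (α u : H → ℝ) :
    Prop where
  smooth : ContMDiff (𝓡 p) 𝓘(ℝ, ℝ) ∞ u
  eq : ∀ h, (1 / 2) * sumSquares A u h = α h

/-- The matrix coefficient `α(Y, Z) (h) = ⟨Ad(h) Y, Z⟩`, a function on `H`. -/
def coeff (B : LinearMap.BilinForm ℝ (GroupLieAlgebra (𝓡 n) G))
    (Y Z : GroupLieAlgebra (𝓡 n) G) (h : H) : ℝ :=
  B (Ad n (h : G) Y) Z

/-- The effective generator `∑ i j, a_{ij} L_{Z_i^*} L_{Z_j^*}` with coefficients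
`a_{ij} = -∫_H α(Y₀, Z_i) 𝓛₀⁻¹(α(Y₀, Z_j)) dh`; here `β j` stands for `𝓛₀⁻¹(α(Y₀, Z_j))`. -/
def effectiveGenerator [MeasurableSpace H] (μ : Measure H)
    (B : LinearMap.BilinForm ℝ (GroupLieAlgebra (𝓡 n) G)) (Y₀ : GroupLieAlgebra (𝓡 n) G) {q : ℕ}
    (Z : Fin q → GroupLieAlgebra (𝓡 n) G) (β : Fin q → H → ℝ) (f : G → ℝ) (g : G) : ℝ :=
  ∑ i, ∑ j, (-∫ h, coeff H B Y₀ (Z i) h * β j h ∂μ) * lieDeriv (Z i) (lieDeriv (Z j) f) g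

end Subgroup

end

end EffectiveLimit

/-!
Let `C` be the Casimir operator `-(1/2) ∑ k, ad²(A_k)` and `U` an irreducible subspace without
nonzero fixed vectors. Each `ad(A_k)` is skew and only a fixed vector is annihilated by all of them,
so `C` is positive definite on `U` and `Y₀ = C X` for some `X ∈ U`. Since `𝓛₀` acts on matrix
coefficients as `-C`, the Poisson equation with right-hand side `⟨Ad(h) Y₀, Z⟩` is solved by
`-⟨Ad(h) X, Z⟩`. The operator `𝓛₀` is symmetric on `L²(H)`, so for any choice of solutions
`a_{ij} = ∫ ⟨Ad(h) X, Z_i⟩ ⟨Ad(h) Y₀, Z_j⟩ dh`, and this is a symmetric invariant bilinear form in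
`(Z_i, Z_j)`. By Schur's lemma it is a multiple of the inner product on `U`; comparing traces, the
factor is `⟨X, Y₀⟩ / dim U`. An eigenbasis gives `X = ∑ m, (c_m / λ_m) Y_m`. If the `A_k` form an
orthonormal basis of `𝔥`, then `C` is itself symmetric and invariant, hence a scalar `λ`, and
`X = λ⁻¹ Y₀`.
-/

namespace EffectiveLimit

open Filter Topology

section Orthonormal

/-- The family `Y` is orthonormal for the bilinear form `B`. -/
def IsOrthonormalFamily {ι R E : Type*} [DecidableEq ι] [CommRing R] [AddCommGroup E] [Module R E]
    (B : LinearMap.BilinForm R E) (Y : ι → E) : Prop :=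
  ∀ i j, B (Y i) (Y j) = if i = j then 1 else 0

namespace IsOrthonormalFamily

variable {ι κ R E : Type*} [DecidableEq ι] [DecidableEq κ] [CommRing R] [AddCommGroup E]
  [Module R E] {B : LinearMap.BilinForm R E} {Y : ι → E} {Z : κ → E}

theorem linearIndependent (hY : IsOrthonormalFamily B Y) : LinearIndependent R Y := by
  rw [linearIndependent_iff']
  intro s c hc i hi
  simpa [hY _ i, hi] using congrArg (fun X => B X (Y i)) hc

variable [Fintype ι] [Fintype κ]

theorem eq_sum (hY : IsOrthonormalFamily B Y) {X : E} (hX : X ∈ Submodule.span R (Set.range Y)) :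
    X = ∑ i, B X (Y i) • Y i := by
  obtain ⟨c, rfl⟩ := (Submodule.mem_span_range_iff_exists_fun R).1 hX
  refine Finset.sum_congr rfl fun i _ => ?_
  simp [hY _ i]

theorem apply_eq_sum (hY : IsOrthonormalFamily B Y) {X : E}
    (hX : X ∈ Submodule.span R (Set.range Y)) (X' : E) :
    B X X' = ∑ i, B X (Y i) * B (Y i) X' := by
  conv_lhs => rw [hY.eq_sum hX]
  simp

theorem apply_sum_sum (hY : IsOrthonormalFamily B Y) (a b : ι → R) :
    B (∑ i, a i • Y i) (∑ i, b i • Y i) = ∑ i, a i * b i := by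
  simp [hY _ _, mul_comm]

theorem finrank_span [Nontrivial R] (hY : IsOrthonormalFamily B Y) :
    Module.finrank R (Submodule.span R (Set.range Y)) = Fintype.card ι :=
  finrank_span_eq_card hY.linearIndependent

theorem sum_apply_self_eq {T : LinearMap.BilinForm R E} (hB : ∀ X X', B X X' = B X' X)
    (hY : IsOrthonormalFamily B Y) (hZ : IsOrthonormalFamily B Z)
    (hYZ : Submodule.span R (Set.range Y) = Submodule.span R (Set.range Z)) :
    ∑ k, T (Z k) (Z k) = ∑ i, T (Y i) (Y i) := by
  have hZY k : Z k = ∑ i, B (Z k) (Y i) • Y i :=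
    hY.eq_sum (hYZ ▸ Submodule.subset_span ⟨k, rfl⟩)
  have parseval i j : ∑ k, B (Z k) (Y i) * B (Z k) (Y j) = if i = j then 1 else 0 := by
    rw [← hY i j, hZ.apply_eq_sum (hYZ ▸ Submodule.subset_span ⟨i, rfl⟩)]
    simp only [hB (Y i)]
  calc ∑ k, T (Z k) (Z k)
      = ∑ k, ∑ i, ∑ j, B (Z k) (Y i) * B (Z k) (Y j) * T (Y i) (Y j) := by
        refine Finset.sum_congr rfl fun k _ => ?_
        conv_lhs => rw [hZY k]
        simp only [map_sum, map_smul, LinearMap.sum_apply, LinearMap.smul_apply, smul_eq_mul]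
        rw [Finset.sum_comm]
        simp only [Finset.mul_sum]
        exact Finset.sum_congr rfl fun i _ => Finset.sum_congr rfl fun j _ => by ring
    _ = ∑ i, ∑ j, (∑ k, B (Z k) (Y i) * B (Z k) (Y j)) * T (Y i) (Y j) := by
        simp only [Finset.sum_mul]
        rw [Finset.sum_comm]
        exact Finset.sum_congr rfl fun i _ => Finset.sum_comm
    _ = ∑ i, T (Y i) (Y i) := by simp [parseval]

end IsOrthonormalFamily

/-- The matrix of `S` in the orthonormal basis has an eigenvector. -/
theorem exists_ne_zero_forall_apply_eq_mul {ι E : Type*} [Finite ι] [DecidableEq ι] [Nonempty ι]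
    [AddCommGroup E] [Module ℝ E] {B S : LinearMap.BilinForm ℝ E} {Y : ι → E}
    (hY : IsOrthonormalFamily B Y) (hS : ∀ i j, S (Y i) (Y j) = S (Y j) (Y i)) :
    ∃ κ : ℝ, ∃ X ∈ Submodule.span ℝ (Set.range Y), X ≠ 0 ∧
      ∀ X' ∈ Submodule.span ℝ (Set.range Y), S X X' = κ * B X X' := by
  cases nonempty_fintype ι
  have hM : (Matrix.of fun i j => S (Y i) (Y j)).IsHermitian := by
    ext i j
    simp [hS i j]
  obtain ⟨i₀⟩ := ‹Nonempty ι›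
  let v := hM.eigenvectorBasis i₀
  have hv : v ≠ 0 := hM.eigenvectorBasis.orthonormal.ne_zero i₀
  have eigen j : ∑ i, S (Y j) (Y i) * v i = hM.eigenvalues i₀ * v j := by
    simpa [Matrix.mulVec, dotProduct] using congrFun (hM.mulVec_eigenvectorBasis i₀) j
  refine ⟨hM.eigenvalues i₀, ∑ i, v i • Y i, Submodule.sum_mem _ fun i _ =>
    Submodule.smul_mem _ _ (Submodule.subset_span ⟨i, rfl⟩), fun h => hv ?_, fun X' hX' => ?_⟩
  · ext i
    simpa using Fintype.linearIndependent_iff.1 hY.linearIndependent _ h i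
  · obtain ⟨c, rfl⟩ := (Submodule.mem_span_range_iff_exists_fun ℝ).1 hX'
    rw [hY.apply_sum_sum, Finset.mul_sum, map_sum]
    refine Finset.sum_congr rfl fun j _ => ?_
    rw [← mul_assoc, ← eigen, Finset.sum_mul]
    simp [hS _ j, Finset.mul_sum, mul_comm]

end Orthonormal

section Schur

/-- The subspace `V` is an irreducible invariant subspace for the representation `ρ`. -/
structure IsIrreducibleSubspace {K R E : Type*} [Monoid K] [CommRing R] [AddCommGroup E]
    [Module R E] (ρ : Representation R K E) (V : Submodule R E) : Prop where
  invariant : ∀ k, ∀ X ∈ V, ρ k X ∈ V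
  ne_bot : V ≠ ⊥
  eq_bot_or_eq : ∀ W ≤ V, (∀ k, ∀ X ∈ W, ρ k X ∈ W) → W = ⊥ ∨ W = V

variable {K E ι : Type*} [Group K] [AddCommGroup E] [Module ℝ E] {ρ : Representation ℝ K E}
  {V : Submodule ℝ E} {B : LinearMap.BilinForm ℝ E} [Finite ι] [DecidableEq ι] {Y : ι → E}

/-- Schur's lemma for invariant symmetric forms: the eigenspace of an eigenvalue is an invariant
subspace. -/
theorem IsIrreducibleSubspace.exists_apply_eq_mul (hV : IsIrreducibleSubspace ρ V)
    (hB : ∀ k X X', B (ρ k X) (ρ k X') = B X X') (hY : IsOrthonormalFamily B Y)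
    (hYV : Submodule.span ℝ (Set.range Y) = V) {S : LinearMap.BilinForm ℝ E}
    (hsymm : ∀ X ∈ V, ∀ X' ∈ V, S X X' = S X' X)
    (hS : ∀ k, ∀ X ∈ V, ∀ X' ∈ V, S (ρ k X) (ρ k X') = S X X') :
    ∃ κ : ℝ, ∀ X ∈ V, ∀ X' ∈ V, S X X' = κ * B X X' := by
  have hmem i : Y i ∈ V := hYV ▸ Submodule.subset_span ⟨i, rfl⟩
  have : Nonempty ι := by
    by_contra h
    rw [not_nonempty_iff] at h
    exact hV.ne_bot (by rw [← hYV, Set.range_eq_empty, Submodule.span_empty])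
  obtain ⟨κ, X₁, hX₁, hne, hκ⟩ := exists_ne_zero_forall_apply_eq_mul hY (S := S)
    fun i j => hsymm _ (hmem i) _ (hmem j)
  rw [hYV] at hX₁ hκ
  let W : Submodule ℝ E := V ⊓ LinearMap.ker ((S - κ • B).compl₂ V.subtype)
  have mem_W {X : E} : X ∈ W ↔ X ∈ V ∧ ∀ X' ∈ V, S X X' = κ * B X X' := by
    simp [W, LinearMap.ext_iff, sub_eq_zero]
  have hW : ∀ k, ∀ X ∈ W, ρ k X ∈ W := by
    simp only [mem_W]
    refine fun k X hX => ⟨hV.invariant k X hX.1, fun X' hX' => ?_⟩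
    have h := hV.invariant k⁻¹ X' hX'
    rw [← ρ.self_inv_apply k X', hS k X hX.1 _ h, hB, hX.2 _ h]
  have hWV : W = V := (hV.eq_bot_or_eq W inf_le_left hW).resolve_left
    ((Submodule.ne_bot_iff W).2 ⟨X₁, mem_W.2 ⟨hX₁, hκ⟩, hne⟩)
  exact ⟨κ, fun X hX => (mem_W.1 (hWV ▸ hX)).2⟩

theorem IsIrreducibleSubspace.exists_apply_eq_smul (hV : IsIrreducibleSubspace ρ V)
    (hB : ∀ k X X', B (ρ k X) (ρ k X') = B X X') (hpos : ∀ X, X ≠ 0 → 0 < B X X)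
    (hY : IsOrthonormalFamily B Y) (hYV : Submodule.span ℝ (Set.range Y) = V)
    {C : Module.End ℝ E} (hC : ∀ X ∈ V, C X ∈ V)
    (hsymm : ∀ X ∈ V, ∀ X' ∈ V, B (C X) X' = B (C X') X)
    (hCρ : ∀ k, ∀ X ∈ V, ∀ X' ∈ V, B (C (ρ k X)) (ρ k X') = B (C X) X') :
    ∃ κ : ℝ, ∀ X ∈ V, C X = κ • X := by
  obtain ⟨κ, hκ⟩ := hV.exists_apply_eq_mul hB hY hYV (S := B.compLeft C) hsymm hCρ
  refine ⟨κ, fun X hX => ?_⟩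
  by_contra hne
  refine (hpos _ (sub_ne_zero.2 hne)).ne' ?_
  rw [LinearMap.map_sub₂, LinearMap.map_smul₂, smul_eq_mul, sub_eq_zero]
  exact hκ X hX _ (V.sub_mem (hC X hX) (V.smul_mem κ hX))

end Schur

section Calculus

variable {𝕜 E F F' : Type*} [NontriviallyNormedField 𝕜] [NormedAddCommGroup E] [NormedSpace 𝕜 E]
  [NormedAddCommGroup F] [NormedSpace 𝕜 F] [NormedAddCommGroup F'] [NormedSpace 𝕜 F']

theorem fderiv_partial_left {m : E × F → F'} {x : E} {y : F}
    (hm : DifferentiableAt 𝕜 m (x, y)) (X : E) :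
    fderiv 𝕜 (fun z => m (z, y)) x X = fderiv 𝕜 m (x, y) (X, 0) := by
  have h := HasFDerivAt.comp (f := fun z => (z, y)) x hm.hasFDerivAt (hasFDerivAt_prodMk_left x y)
  exact DFunLike.congr_fun h.fderiv X

theorem fderiv_partial_right {m : E × F → F'} {x : E} {y : F}
    (hm : DifferentiableAt 𝕜 m (x, y)) (Y : F) :
    fderiv 𝕜 (fun z => m (x, z)) y Y = fderiv 𝕜 m (x, y) (0, Y) := by
  have h := HasFDerivAt.comp (f := fun z => (x, z)) y hm.hasFDerivAt (hasFDerivAt_prodMk_right x y)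
  exact DFunLike.congr_fun h.fderiv Y

theorem fderiv_fderiv_partial_right {m : E × F → F'} {x : E} {y : F}
    (hm : ContDiffAt 𝕜 2 m (x, y)) (X : E) (Y : F) :
    fderiv 𝕜 (fun z => fderiv 𝕜 (fun w => m (z, w)) y Y) x X
      = fderiv 𝕜 (fderiv 𝕜 m) (x, y) (X, 0) (0, Y) := by
  have hm' : DifferentiableAt 𝕜 (fderiv 𝕜 m) (x, y) :=
    (hm.fderiv_right (m := 1) (by norm_num)).differentiableAt (by simp)
  have hd : ∀ᶠ z in 𝓝 x, DifferentiableAt 𝕜 m (z, y) :=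
    ((Continuous.prodMk_left y).tendsto x).eventually
      ((hm.eventually (by simp)).mono fun p hp => hp.differentiableAt (by simp))
  have e : (fun z => fderiv 𝕜 (fun w => m (z, w)) y Y) =ᶠ[𝓝 x]
      fun z => fderiv 𝕜 m (z, y) (0, Y) := hd.mono fun z hz => fderiv_partial_right hz Y
  have h := (HasFDerivAt.comp (f := fun z => (z, y)) x hm'.hasFDerivAt
    (hasFDerivAt_prodMk_left x y)).clm_apply (hasFDerivAt_const ((0 : E), Y) x)
  rw [e.fderiv_eq]
  simpa using DFunLike.congr_fun h.fderiv X

theorem fderiv_fderiv_partial_left_apply {m : E × F → F'} {x : E} {y : F}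
    (hm : ContDiffAt 𝕜 2 m (x, y)) {T : F → E} (hT : DifferentiableAt 𝕜 T y) (Y : F) :
    fderiv 𝕜 (fun z => fderiv 𝕜 (fun w => m (w, z)) x (T z)) y Y
      = fderiv 𝕜 (fderiv 𝕜 m) (x, y) (0, Y) (T y, 0)
        + fderiv 𝕜 m (x, y) (fderiv 𝕜 T y Y, 0) := by
  have hm' : DifferentiableAt 𝕜 (fderiv 𝕜 m) (x, y) :=
    (hm.fderiv_right (m := 1) (by norm_num)).differentiableAt (by simp)
  have hd : ∀ᶠ z in 𝓝 y, DifferentiableAt 𝕜 m (x, z) :=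
    ((Continuous.prodMk_right x).tendsto y).eventually
      ((hm.eventually (by simp)).mono fun p hp => hp.differentiableAt (by simp))
  have e : (fun z => fderiv 𝕜 (fun w => m (w, z)) x (T z)) =ᶠ[𝓝 y]
      fun z => fderiv 𝕜 m (x, z) (T z, 0) := hd.mono fun z hz => fderiv_partial_left hz (T z)
  have h := (HasFDerivAt.comp (f := fun z => (x, z)) y hm'.hasFDerivAt
    (hasFDerivAt_prodMk_right x y)).clm_apply
    (hT.hasFDerivAt.prodMk (hasFDerivAt_const (0 : F) y))
  rw [e.fderiv_eq]
  simpa [add_comm] using DFunLike.congr_fun h.fderiv Y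

/-- Here `m` is a group law in a chart and `T x` is `Ad x Y`: the derivative of `Ad` is the
antisymmetrised mixed second derivative of the group law. -/
theorem fderiv_eq_sub_of_fderiv_partial_eq {E : Type*} [NormedAddCommGroup E] [NormedSpace ℝ E]
    {m : E × E → E} {x₀ : E} (hm : ContDiffAt ℝ 2 m (x₀, x₀))
    (hunit : ∀ᶠ x in 𝓝 x₀, m (x, x₀) = x) {T : E → E} (hT : DifferentiableAt ℝ T x₀)
    (h : ∀ᶠ x in 𝓝 x₀,
      fderiv ℝ (fun y => m (x, y)) x₀ (T x₀) = fderiv ℝ (fun y => m (y, x)) x₀ (T x)) (X : E) :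
    fderiv ℝ T x₀ X = fderiv ℝ (fun x => fderiv ℝ (fun y => m (x, y)) x₀ (T x₀)) x₀ X
      - fderiv ℝ (fun x => fderiv ℝ (fun y => m (x, y)) x₀ X) x₀ (T x₀) := by
  have hid : fderiv ℝ m (x₀, x₀) (fderiv ℝ T x₀ X, 0) = fderiv ℝ T x₀ X := by
    rw [← fderiv_partial_left (hm.differentiableAt (by simp)),
      EventuallyEq.fderiv_eq (f := fun x => x) hunit, fderiv_fun_id,
      ContinuousLinearMap.id_apply]
  rw [EventuallyEq.fderiv_eq h, fderiv_fderiv_partial_left_apply hm hT,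
    fderiv_fderiv_partial_right hm, (hm.isSymmSndFDerivAt (by simp)).eq, hid, add_sub_cancel_left]

end Calculus

section CoordinateDerivative

variable {E : Type*} [NormedAddCommGroup E] [NormedSpace ℝ E]
  {H : Type*} [TopologicalSpace H] (I : ModelWithCorners ℝ E H)
  {E' : Type*} [NormedAddCommGroup E'] [NormedSpace ℝ E']
  {H' : Type*} [TopologicalSpace H'] (I' : ModelWithCorners ℝ E' H')
  {E'' : Type*} [NormedAddCommGroup E''] [NormedSpace ℝ E'']
  {H'' : Type*} [TopologicalSpace H''] {I'' : ModelWithCorners ℝ E'' H''}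
  {M : Type*} [TopologicalSpace M] [ChartedSpace H M]
  {M' : Type*} [TopologicalSpace M'] [ChartedSpace H' M']
  {M'' : Type*} [TopologicalSpace M''] [ChartedSpace H'' M'']

/-- The derivative of a map between manifolds, as a map between the model vector spaces. Its type
does not depend on the point, unlike that of `mfderiv`, so that derivatives at points that are only
propositionally equal can be compared. -/
noncomputable def coordDeriv (f : M → M') (x : M) : E →L[ℝ] E' := mfderiv I I' f x

variable {I I'}

theorem coordDeriv_comp {f : M → M'} {g : M' → M''} {x : M} {y : M'} (hy : f x = y)
    (hg : MDifferentiableAt I' I'' g y) (hf : MDifferentiableAt I I' f x) (v : E) :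
    coordDeriv I I'' (fun z => g (f z)) x v = coordDeriv I' I'' g y (coordDeriv I I' f x v) := by
  subst hy
  exact DFunLike.congr_fun (F := E →L[ℝ] E'') (mfderiv_comp x hg hf) v

theorem coordDeriv_id (x : M) (v : E) : coordDeriv I I (fun y : M => y) x v = v :=
  DFunLike.congr_fun (F := E →L[ℝ] E) mfderiv_id v

theorem coordDeriv_const (x : M) (y : M') (v : E) : coordDeriv I I' (fun _ : M => y) x v = 0 :=
  DFunLike.congr_fun (F := E →L[ℝ] E') mfderiv_const v

theorem coordDeriv_eq_fderiv (f : E → E') (x : E) :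
    coordDeriv 𝓘(ℝ, E) 𝓘(ℝ, E') f x = fderiv ℝ f x :=
  mfderiv_eq_fderiv

theorem coordDeriv_eq_fderiv_comp_symm [I.Boundaryless] {f : M → E'} {x : M}
    (hf : MDifferentiableAt I 𝓘(ℝ, E') f x) :
    coordDeriv I 𝓘(ℝ, E') f x
      = fderiv ℝ (fun y => f ((extChartAt I x).symm y)) (extChartAt I x x) := by
  refine hf.mfderiv.trans ?_
  rw [I.range_eq_univ, fderivWithin_univ]
  rfl

theorem coordDeriv_extChartAt_self [IsManifold I 1 M] (x : M) (v : E) :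
    coordDeriv I 𝓘(ℝ, E) (extChartAt I x) x v = v :=
  DFunLike.congr_fun (F := E →L[ℝ] E) mfderiv_extChartAt_self v

/-- In the coordinates of the fixed chart at `x₀`, the partial derivative at `x₀` is `coordDeriv`
itself. -/
theorem contMDiffAt_coordDeriv [IsManifold I 1 M] [IsManifold I' 1 M'] {r s : WithTop ℕ∞}
    (hrs : r + 1 ≤ s) {f : M' → M → E''} {y₀ : M'} {x₀ : M}
    (hf : ContMDiffAt (I'.prod I) 𝓘(ℝ, E'') s (Function.uncurry f) (y₀, x₀)) (v : E) :
    ContMDiffAt I' 𝓘(ℝ, E'') r (fun y => coordDeriv I 𝓘(ℝ, E'') (f y) x₀ v) y₀ := by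
  have h := ContMDiffAt.mfderiv_apply f (fun _ => x₀) id (fun _ => v) hf
    contMDiffAt_const contMDiffAt_id contMDiffAt_const hrs
  refine h.congr_of_eventuallyEq (Eventually.of_forall fun y => ?_)
  have e := inTangentCoordinates_eq (I := I) (I' := 𝓘(ℝ, E'')) (fun _ : M' => x₀) (fun y => f y x₀)
    (fun y => coordDeriv I 𝓘(ℝ, E'') (f y) x₀) (x₀ := y₀) (x := y) (mem_chart_source _ _)
    (Set.mem_univ _)
  refine Eq.trans ?_ (DFunLike.congr_fun e v).symm
  have e' := (tangentBundleCore I M).coordChange_self (achart H x₀) x₀ (mem_chart_source H x₀) v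
  rw [ContinuousLinearMap.comp_apply, ContinuousLinearMap.comp_apply, e',
    tangentBundleCore_coordChange_model_space]
  rfl

theorem mdifferentiableAt_extChartAt_symm [IsManifold I 1 M] [I.Boundaryless] {x : M} {z : E}
    (hz : z ∈ (extChartAt I x).target) :
    MDifferentiableAt 𝓘(ℝ, E) I (extChartAt I x).symm z := by
  simpa only [I.range_eq_univ, mdifferentiableWithinAt_univ]
    using mdifferentiableWithinAt_extChartAt_symm hz

theorem isLocallyConstant_of_coordDeriv_eq_zero [IsManifold I 1 M] [I.Boundaryless] {f : M → E'}
    (hf : MDifferentiable I 𝓘(ℝ, E') f) (h : ∀ x v, coordDeriv I 𝓘(ℝ, E') f x v = 0) :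
    IsLocallyConstant f := by
  refine (IsLocallyConstant.iff_eventually_eq f).2 fun x => ?_
  set φ := extChartAt I x
  obtain ⟨δ, hδ, hball⟩ := Metric.mem_nhds_iff.1 (extChartAt_target_mem_nhds (I := I) x)
  have hdiff : DifferentiableOn ℝ (fun z => f (φ.symm z)) (Metric.ball (φ x) δ) := fun z hz =>
    (mdifferentiableAt_iff_differentiableAt.1 ((hf _).comp z
      (mdifferentiableAt_extChartAt_symm (hball hz)))).differentiableWithinAt
  have hzero : (Metric.ball (φ x) δ).EqOn (fderiv ℝ fun z => f (φ.symm z)) 0 := fun z hz => by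
    ext v
    rw [← coordDeriv_eq_fderiv, coordDeriv_comp rfl (hf _)
      (mdifferentiableAt_extChartAt_symm (hball hz)), h, Pi.zero_apply, zero_apply]
  have hconst z (hz : z ∈ Metric.ball (φ x) δ) : f (φ.symm z) = f (φ.symm (φ x)) :=
    Metric.isOpen_ball.is_const_of_fderiv_eq_zero (convex_ball (φ x) δ).isPreconnected hdiff
      hzero hz (Metric.mem_ball_self hδ)
  filter_upwards [extChartAt_source_mem_nhds (I := I) x,
    (continuousAt_extChartAt (I := I) x).preimage_mem_nhds (Metric.ball_mem_nhds _ hδ)]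
    with z hz' hz
  simpa only [φ.left_inv hz', φ.left_inv (mem_extChartAt_source x)] using hconst (φ z) hz

end CoordinateDerivative

section AdjointAction

variable {n : ℕ} {G : Type*} [TopologicalSpace G] [Group G]
  [ChartedSpace (EuclideanSpace ℝ (Fin n)) G]

variable (n) in
/-- The adjoint action `Ad g`, on the model space, where functions of `g` can be differentiated. -/
noncomputable def coordAd (g : G) : EuclideanSpace ℝ (Fin n) →L[ℝ] EuclideanSpace ℝ (Fin n) :=
  coordDeriv (𝓡 n) (𝓡 n) (fun x : G => g * x * g⁻¹) 1

theorem coordAd_one (v : EuclideanSpace ℝ (Fin n)) : coordAd n (1 : G) v = v := by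
  simpa [coordAd] using coordDeriv_id (1 : G) v

variable [LieGroup (𝓡 n) ∞ G]

theorem mdifferentiable_mul_left (g : G) : MDifferentiable (𝓡 n) (𝓡 n) fun x : G => g * x :=
  (contMDiff_mul_left (I := 𝓡 n) (n := ∞)).mdifferentiable (by simp)

theorem mdifferentiable_mul_right (g : G) : MDifferentiable (𝓡 n) (𝓡 n) fun x : G => x * g :=
  (contMDiff_mul_right (I := 𝓡 n) (n := ∞)).mdifferentiable (by simp)

theorem mdifferentiable_conj (g : G) : MDifferentiable (𝓡 n) (𝓡 n) fun x : G => g * x * g⁻¹ :=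
  (mdifferentiable_mul_right g⁻¹).comp (mdifferentiable_mul_left g)

theorem coordAd_mul (g h : G) (v : EuclideanSpace ℝ (Fin n)) :
    coordAd n (g * h) v = coordAd n g (coordAd n h v) := by
  simpa only [coordAd, mul_inv_rev, mul_assoc] using
    coordDeriv_comp (y := (1 : G)) (by simp) (mdifferentiable_conj g 1) (mdifferentiable_conj h 1) v

variable (n G) in
/-- The adjoint representation of a Lie group on its Lie algebra. -/
noncomputable def adRep : Representation ℝ G (GroupLieAlgebra (𝓡 n) G) where
  toFun := Ad n
  map_one' := LinearMap.ext coordAd_one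
  map_mul' g h := LinearMap.ext (coordAd_mul g h)

/-- In the chart at the identity, which is fixed by conjugation and has the identity as its
derivative there, `Ad` is a partial derivative of `(g, x) ↦ g x g⁻¹`. -/
theorem contMDiff_coordAd_apply (v : EuclideanSpace ℝ (Fin n)) :
    ContMDiff (𝓡 n) (𝓡 n) ∞ fun g : G => coordAd n g v := by
  intro g₀
  have hconj : ContMDiff ((𝓡 n).prod (𝓡 n)) (𝓡 n) ∞ fun p : G × G => p.1 * p.2 * p.1⁻¹ :=
    (contMDiff_fst.mul contMDiff_snd).mul contMDiff_fst.inv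
  have h : ContMDiffAt ((𝓡 n).prod (𝓡 n)) (𝓡 n) ∞
      (Function.uncurry fun g x : G => extChartAt (𝓡 n) (1 : G) (g * x * g⁻¹)) (g₀, 1) :=
    contMDiffAt_extChartAt.comp_of_eq hconj.contMDiffAt (by simp)
  refine (contMDiffAt_coordDeriv (r := ∞) le_rfl h v).congr_of_eventuallyEq
    (Eventually.of_forall fun g => ?_)
  beta_reduce
  rw [coordDeriv_comp (y := (1 : G)) (by simp)
    (mdifferentiableAt_extChartAt (mem_chart_source _ _)) (mdifferentiable_conj g 1) v,
    coordDeriv_extChartAt_self, coordAd]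

end AdjointAction

section Bracket

variable {n : ℕ} {G : Type*} [TopologicalSpace G] [Group G]
  [ChartedSpace (EuclideanSpace ℝ (Fin n)) G]

variable (n G) in
/-- The group law in the chart at the identity. It is meaningful near the point
`(extChartAt (𝓡 n) 1 1, extChartAt (𝓡 n) 1 1)`. -/
noncomputable def mulInChart (q : EuclideanSpace ℝ (Fin n) × EuclideanSpace ℝ (Fin n)) :
    EuclideanSpace ℝ (Fin n) :=
  extChartAt (𝓡 n) (1 : G)
    ((extChartAt (𝓡 n) (1 : G)).symm q.1 * (extChartAt (𝓡 n) (1 : G)).symm q.2)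

variable (G) in
/-- The left-invariant vector field generated by `Z`, in the chart at the identity. -/
noncomputable def invariantFieldInChart (Z : EuclideanSpace ℝ (Fin n)) :
    EuclideanSpace ℝ (Fin n) → EuclideanSpace ℝ (Fin n) :=
  VectorField.mpullbackWithin (𝓡 n) (𝓡 n) (extChartAt (𝓡 n) (1 : G)).symm
    (mulInvariantVectorField (I := 𝓡 n) (G := G) Z) Set.univ

theorem mulInChart_one_left {x : EuclideanSpace ℝ (Fin n)}
    (hx : x ∈ (extChartAt (𝓡 n) (1 : G)).target) :
    mulInChart n G (extChartAt (𝓡 n) (1 : G) 1, x) = x := by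
  simpa [mulInChart] using (extChartAt (𝓡 n) (1 : G)).right_inv hx

theorem mulInChart_one_right {x : EuclideanSpace ℝ (Fin n)}
    (hx : x ∈ (extChartAt (𝓡 n) (1 : G)).target) :
    mulInChart n G (x, extChartAt (𝓡 n) (1 : G) 1) = x := by
  simpa [mulInChart] using (extChartAt (𝓡 n) (1 : G)).right_inv hx

theorem invariantFieldInChart_lie [IsManifold (𝓡 n) 1 G] (X Y : GroupLieAlgebra (𝓡 n) G) :
    fderiv ℝ (invariantFieldInChart G Y) (extChartAt (𝓡 n) (1 : G) 1)
        (invariantFieldInChart G X (extChartAt (𝓡 n) (1 : G) 1))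
      - fderiv ℝ (invariantFieldInChart G X) (extChartAt (𝓡 n) (1 : G) 1)
        (invariantFieldInChart G Y (extChartAt (𝓡 n) (1 : G) 1)) = ⁅X, Y⁆ := by
  have h (v : EuclideanSpace ℝ (Fin n)) :
      (mfderiv (𝓡 n) (𝓡 n) (extChartAt (𝓡 n) (1 : G)) 1).inverse v = v := by
    rw [mfderiv_extChartAt_self]
    exact DFunLike.congr_fun
      (ContinuousLinearMap.inverse_id (R := ℝ) (M := EuclideanSpace ℝ (Fin n))) v
  rw [GroupLieAlgebra.bracket_def]
  refine Eq.trans ?_ (h _).symm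
  rw [Set.preimage_univ, ModelWithCorners.range_eq_univ, Set.univ_inter]
  exact (congrFun (VectorField.lieBracketWithin_univ (𝕜 := ℝ)) _).symm

variable [LieGroup (𝓡 n) ∞ G]

theorem contDiffAt_mulInChart :
    ContDiffAt ℝ ∞ (mulInChart n G)
      (extChartAt (𝓡 n) (1 : G) 1, extChartAt (𝓡 n) (1 : G) 1) := by
  have hsymm : ContMDiffAt (𝓡 n) (𝓡 n) ∞ (extChartAt (𝓡 n) (1 : G)).symm
      (extChartAt (𝓡 n) (1 : G) 1) :=
    (contMDiffOn_extChartAt_symm 1).contMDiffAt (extChartAt_target_mem_nhds 1)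
  rw [← contMDiffAt_iff_contDiffAt]
  exact contMDiffAt_extChartAt.comp_of_eq
    ((hsymm.comp (_, _) contDiffAt_fst.contMDiffAt).mul
      (hsymm.comp (_, _) contDiffAt_snd.contMDiffAt)) (by simp)

theorem mdifferentiableAt_extChartAt_of_mem_target {x : EuclideanSpace ℝ (Fin n)}
    (hx : x ∈ (extChartAt (𝓡 n) (1 : G)).target) :
    MDifferentiableAt (𝓡 n) (𝓡 n) (extChartAt (𝓡 n) (1 : G)) ((extChartAt (𝓡 n) (1 : G)).symm x) :=
  mdifferentiableAt_extChartAt (by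
    rw [← extChartAt_source (𝓡 n)]
    exact (extChartAt (𝓡 n) (1 : G)).map_target hx)

theorem fderiv_mulInChart_right {x : EuclideanSpace ℝ (Fin n)}
    (hx : x ∈ (extChartAt (𝓡 n) (1 : G)).target) (Z : EuclideanSpace ℝ (Fin n)) :
    fderiv ℝ (fun y => mulInChart n G (x, y)) (extChartAt (𝓡 n) (1 : G) 1) Z
      = coordDeriv (𝓡 n) (𝓡 n)
        (fun g : G => extChartAt (𝓡 n) (1 : G) ((extChartAt (𝓡 n) (1 : G)).symm x * g)) 1 Z :=
  (DFunLike.congr_fun (coordDeriv_eq_fderiv_comp_symm (MDifferentiableAt.comp_of_eq _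
    (mdifferentiableAt_extChartAt_of_mem_target hx) (mdifferentiable_mul_left _ 1)
    (mul_one _))) Z).symm

theorem fderiv_mulInChart_left {x : EuclideanSpace ℝ (Fin n)}
    (hx : x ∈ (extChartAt (𝓡 n) (1 : G)).target) (Z : EuclideanSpace ℝ (Fin n)) :
    fderiv ℝ (fun y => mulInChart n G (y, x)) (extChartAt (𝓡 n) (1 : G) 1) Z
      = coordDeriv (𝓡 n) (𝓡 n)
        (fun g : G => extChartAt (𝓡 n) (1 : G) (g * (extChartAt (𝓡 n) (1 : G)).symm x)) 1 Z :=
  (DFunLike.congr_fun (coordDeriv_eq_fderiv_comp_symm (MDifferentiableAt.comp_of_eq _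
    (mdifferentiableAt_extChartAt_of_mem_target hx) (mdifferentiable_mul_right _ 1)
    (one_mul _))) Z).symm

theorem invariantFieldInChart_eq_fderiv {x : EuclideanSpace ℝ (Fin n)}
    (hx : x ∈ (extChartAt (𝓡 n) (1 : G)).target) (Z : EuclideanSpace ℝ (Fin n)) :
    invariantFieldInChart G Z x
      = fderiv ℝ (fun y => mulInChart n G (x, y)) (extChartAt (𝓡 n) (1 : G) 1) Z := by
  rw [fderiv_mulInChart_right hx, coordDeriv_comp (mul_one _)
    (mdifferentiableAt_extChartAt_of_mem_target hx) (mdifferentiable_mul_left _ 1)]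
  refine (VectorField.mpullbackWithin_apply ..).trans ?_
  have h₁ := mfderivWithin_extChartAt_symm_comp_mfderiv_extChartAt hx
  have h₂ := mfderiv_extChartAt_comp_mfderivWithin_extChartAt_symm hx
  rw [ModelWithCorners.range_eq_univ] at h₁ h₂
  rw [ContinuousLinearMap.inverse_eq h₁ h₂]
  rfl

theorem invariantFieldInChart_one (Z : EuclideanSpace ℝ (Fin n)) :
    invariantFieldInChart G Z (extChartAt (𝓡 n) (1 : G) 1) = Z := by
  have h : (fun y => mulInChart n G (extChartAt (𝓡 n) (1 : G) 1, y))
      =ᶠ[𝓝 (extChartAt (𝓡 n) (1 : G) 1)] fun y => y :=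
    eventually_of_mem (extChartAt_target_mem_nhds (I := 𝓡 n) (1 : G)) fun _ => mulInChart_one_left
  rw [invariantFieldInChart_eq_fderiv (mem_extChartAt_target 1), h.fderiv_eq, fderiv_fun_id,
    ContinuousLinearMap.id_apply]

/-- In a chart: `x exp(tY) = exp(t Ad x Y) x`, differentiated in `t`. -/
theorem fderiv_mulInChart_right_eq_left {x : EuclideanSpace ℝ (Fin n)}
    (hx : x ∈ (extChartAt (𝓡 n) (1 : G)).target) (Y : EuclideanSpace ℝ (Fin n)) :
    fderiv ℝ (fun y => mulInChart n G (x, y)) (extChartAt (𝓡 n) (1 : G) 1) Y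
      = fderiv ℝ (fun y => mulInChart n G (y, x)) (extChartAt (𝓡 n) (1 : G) 1)
        (coordAd n ((extChartAt (𝓡 n) (1 : G)).symm x) Y) := by
  have h := coordDeriv_comp (y := (1 : G)) (by simp)
    (MDifferentiableAt.comp_of_eq _ (mdifferentiableAt_extChartAt_of_mem_target hx)
      (mdifferentiable_mul_right _ 1) (one_mul _))
    (mdifferentiable_conj ((extChartAt (𝓡 n) (1 : G)).symm x) 1) Y
  simp only [Function.comp_apply, inv_mul_cancel_right] at h
  rw [fderiv_mulInChart_right hx, fderiv_mulInChart_left hx]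
  exact h

theorem coordDeriv_coordAd_apply_one (v w : EuclideanSpace ℝ (Fin n)) :
    coordDeriv (𝓡 n) (𝓡 n) (fun g : G => coordAd n g w) 1 v =
      fderiv ℝ (invariantFieldInChart G w) (extChartAt (𝓡 n) (1 : G) 1)
          (invariantFieldInChart G v (extChartAt (𝓡 n) (1 : G) 1))
        - fderiv ℝ (invariantFieldInChart G v) (extChartAt (𝓡 n) (1 : G) 1)
          (invariantFieldInChart G w (extChartAt (𝓡 n) (1 : G) 1)) := by
  rw [invariantFieldInChart_one, invariantFieldInChart_one]
  have hAd := contMDiff_coordAd_apply (G := G) w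
  have htarget : ∀ᶠ x in 𝓝 (extChartAt (𝓡 n) (1 : G) 1), x ∈ (extChartAt (𝓡 n) (1 : G)).target :=
    extChartAt_target_mem_nhds 1
  let T (x : EuclideanSpace ℝ (Fin n)) := coordAd n ((extChartAt (𝓡 n) (1 : G)).symm x) w
  have hT : DifferentiableAt ℝ T (extChartAt (𝓡 n) (1 : G) 1) :=
    mdifferentiableAt_iff_differentiableAt.1 ((hAd.mdifferentiable (by simp) _).comp _
      (mdifferentiableAt_extChartAt_symm (mem_extChartAt_target 1)))
  have hT₁ : T (extChartAt (𝓡 n) (1 : G) 1) = w := by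
    simp only [T, extChartAt_to_inv, coordAd_one]
  have hfield z : (fun x => fderiv ℝ (fun y => mulInChart n G (x, y))
      (extChartAt (𝓡 n) (1 : G) 1) z)
        =ᶠ[𝓝 (extChartAt (𝓡 n) (1 : G) 1)] invariantFieldInChart G z :=
    htarget.mono fun x hx => (invariantFieldInChart_eq_fderiv hx z).symm
  have key := fderiv_eq_sub_of_fderiv_partial_eq
    (contDiffAt_mulInChart.of_le (WithTop.coe_le_coe.mpr le_top))
    (htarget.mono fun x hx => mulInChart_one_right hx) hT
    (htarget.mono fun x hx => by rw [hT₁, fderiv_mulInChart_right_eq_left hx]) v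
  rw [hT₁, (hfield _).fderiv_eq, (hfield _).fderiv_eq] at key
  rw [coordDeriv_eq_fderiv_comp_symm (hAd.mdifferentiable (by simp) 1), key]

theorem coordDeriv_coordAd_apply_one_eq_lie (X Y : GroupLieAlgebra (𝓡 n) G) :
    coordDeriv (𝓡 n) (𝓡 n) (fun g : G => coordAd n g Y) 1 X = ⁅X, Y⁆ :=
  (coordDeriv_coordAd_apply_one X Y).trans (invariantFieldInChart_lie X Y)

theorem coordDeriv_clm_coordAd_one {F : Type*} [NormedAddCommGroup F] [NormedSpace ℝ F]
    (L : EuclideanSpace ℝ (Fin n) →L[ℝ] F) (X Y : GroupLieAlgebra (𝓡 n) G) :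
    coordDeriv (𝓡 n) 𝓘(ℝ, F) (fun g : G => L (coordAd n g Y)) 1 X
      = L (⁅X, Y⁆ : GroupLieAlgebra (𝓡 n) G) := by
  refine (coordDeriv_comp rfl L.differentiableAt.mdifferentiableAt
    ((contMDiff_coordAd_apply (G := G) Y).mdifferentiable (by simp) 1) X).trans ?_
  rw [coordDeriv_eq_fderiv, L.fderiv]
  exact congrArg L (coordDeriv_coordAd_apply_one_eq_lie X Y)

/-- Differentiate `Ad g ∘ Ad k = Ad (g k g⁻¹) ∘ Ad g` in `k`. -/
theorem Ad_lie (g : G) (X Y : GroupLieAlgebra (𝓡 n) G) :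
    Ad n g ⁅X, Y⁆ = ⁅Ad n g X, Ad n g Y⁆ := by
  have hconj (v w : EuclideanSpace ℝ (Fin n)) := calc
    coordDeriv (𝓡 n) (𝓡 n) (fun k : G => coordAd n g (coordAd n k w)) 1 v
      = coordDeriv (𝓡 n) (𝓡 n) (fun k : G => coordAd n (g * k * g⁻¹) (coordAd n g w)) 1 v := by
        simp only [← coordAd_mul, inv_mul_cancel_right]
    _ = coordDeriv (𝓡 n) (𝓡 n) (fun k : G => coordAd n k (coordAd n g w)) 1 (coordAd n g v) :=
        coordDeriv_comp (y := (1 : G)) (by simp)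
          ((contMDiff_coordAd_apply (coordAd n g w)).mdifferentiable (by simp) 1)
          (mdifferentiable_conj g 1) v
  exact (coordDeriv_clm_coordAd_one (coordAd n g) X Y).symm.trans
    ((hconj X Y).trans (coordDeriv_coordAd_apply_one_eq_lie (Ad n g X) (Ad n g Y)))

end Bracket

section LieDerivative

variable {n : ℕ} {G : Type*} [TopologicalSpace G] [Group G]
  [ChartedSpace (EuclideanSpace ℝ (Fin n)) G]

theorem lieDeriv_sum_left {ι : Type*} (s : Finset ι) (c : ι → ℝ) (X : ι → GroupLieAlgebra (𝓡 n) G)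
    (f : G → ℝ) (g : G) :
    lieDeriv (∑ i ∈ s, c i • X i) f g = ∑ i ∈ s, c i * lieDeriv (X i) f g := by
  let L : GroupLieAlgebra (𝓡 n) G →ₗ[ℝ] ℝ := ((mfderiv (𝓡 n) 𝓘(ℝ, ℝ) f g).toLinearMap).comp
    (mfderiv (𝓡 n) (𝓡 n) (g * ·) (1 : G)).toLinearMap
  exact (map_sum L _ _).trans (Finset.sum_congr rfl fun i _ => map_smul L _ _)

theorem lieDeriv_const (X : GroupLieAlgebra (𝓡 n) G) (c : ℝ) (g : G) :
    lieDeriv X (fun _ => c) g = 0 :=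
  coordDeriv_const (I := 𝓡 n) (I' := 𝓘(ℝ, ℝ)) g c (mulInvariantVectorField X g)

theorem lieDeriv_mul {f₁ f₂ : G → ℝ} {g : G} (h₁ : MDifferentiableAt (𝓡 n) 𝓘(ℝ, ℝ) f₁ g)
    (h₂ : MDifferentiableAt (𝓡 n) 𝓘(ℝ, ℝ) f₂ g) (X : GroupLieAlgebra (𝓡 n) G) :
    lieDeriv X (fun x => f₁ x * f₂ x) g = f₁ g * lieDeriv X f₂ g + f₂ g * lieDeriv X f₁ g :=
  DFunLike.congr_fun (F := EuclideanSpace ℝ (Fin n) →L[ℝ] ℝ)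
    (h₁.hasMFDerivAt.mul h₂.hasMFDerivAt).mfderiv (mulInvariantVectorField X g)

theorem lieDeriv_const_mul_add {f₁ f₂ : G → ℝ} {g : G} (c : ℝ)
    (h₁ : MDifferentiableAt (𝓡 n) 𝓘(ℝ, ℝ) f₁ g) (h₂ : MDifferentiableAt (𝓡 n) 𝓘(ℝ, ℝ) f₂ g)
    (X : GroupLieAlgebra (𝓡 n) G) :
    lieDeriv X (fun x => c * f₁ x + f₂ x) g = c * lieDeriv X f₁ g + lieDeriv X f₂ g :=
  DFunLike.congr_fun (F := EuclideanSpace ℝ (Fin n) →L[ℝ] ℝ)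
    ((h₁.hasMFDerivAt.const_smul c).add h₂.hasMFDerivAt).mfderiv (mulInvariantVectorField X g)

theorem lieDeriv_sum_mul {ι : Type*} (s : Finset ι) (c : ι → ℝ) {f : ι → G → ℝ} {g : G}
    (h : ∀ i, MDifferentiableAt (𝓡 n) 𝓘(ℝ, ℝ) (f i) g) (X : GroupLieAlgebra (𝓡 n) G) :
    lieDeriv X (fun x => ∑ i ∈ s, c i * f i x) g = ∑ i ∈ s, c i * lieDeriv X (f i) g := by
  classical
  suffices MDifferentiableAt (𝓡 n) 𝓘(ℝ, ℝ) (fun x => ∑ i ∈ s, c i * f i x) g ∧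
      lieDeriv X (fun x => ∑ i ∈ s, c i * f i x) g = ∑ i ∈ s, c i * lieDeriv X (f i) g from this.2
  induction s using Finset.induction_on with
  | empty => exact ⟨mdifferentiableAt_const, lieDeriv_const X 0 g⟩
  | insert i s hi ih =>
    simp only [Finset.sum_insert hi]
    exact ⟨((h i).const_smul (c i)).add ih.1, by rw [lieDeriv_const_mul_add _ (h i) ih.1, ih.2]⟩

theorem hasDerivAt_comp_of_hasMFDerivAt {f : G → ℝ} {γ : ℝ → G} {t : ℝ}
    {X : GroupLieAlgebra (𝓡 n) G} (hf : MDifferentiableAt (𝓡 n) 𝓘(ℝ, ℝ) f (γ t))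
    (hγ : HasMFDerivAt 𝓘(ℝ, ℝ) (𝓡 n) γ t
      ((1 : ℝ →L[ℝ] ℝ).smulRight (mulInvariantVectorField X (γ t)))) :
    HasDerivAt (fun s => f (γ s)) (lieDeriv X f (γ t)) t := by
  let v : EuclideanSpace ℝ (Fin n) := mulInvariantVectorField X (γ t)
  have h : HasFDerivAt (fun s => f (γ s))
      ((coordDeriv (𝓡 n) 𝓘(ℝ, ℝ) f (γ t)).comp ((1 : ℝ →L[ℝ] ℝ).smulRight v)) t :=
    (hf.hasMFDerivAt.comp t hγ).hasFDerivAt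
  exact h.hasDerivAt.congr_deriv (congrArg (coordDeriv (𝓡 n) 𝓘(ℝ, ℝ) f (γ t)) (one_smul ℝ v))

variable [LieGroup (𝓡 n) ∞ G]

theorem lieDeriv_eq_coordDeriv {f : G → ℝ} {g : G} (hf : MDifferentiableAt (𝓡 n) 𝓘(ℝ, ℝ) f g)
    (X : GroupLieAlgebra (𝓡 n) G) :
    lieDeriv X f g = coordDeriv (𝓡 n) 𝓘(ℝ, ℝ) (fun k => f (g * k)) 1 X :=
  (coordDeriv_comp (mul_one g) hf (mdifferentiable_mul_left g 1) X).symm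

theorem lieDeriv_comp_mul_left {f : G → ℝ} (hf : MDifferentiable (𝓡 n) 𝓘(ℝ, ℝ) f)
    (X : GroupLieAlgebra (𝓡 n) G) (g k : G) :
    lieDeriv X (fun x => f (g * x)) k = lieDeriv X f (g * k) := by
  refine (lieDeriv_eq_coordDeriv ((hf.comp (mdifferentiable_mul_left g)) k) X).trans ?_
  simp only [Function.comp_apply, ← mul_assoc]
  exact (lieDeriv_eq_coordDeriv (hf _) X).symm

theorem contMDiff_lieDeriv {r s : ℕ∞} (hrs : r + 1 ≤ s) {f : G → ℝ}
    (hf : ContMDiff (𝓡 n) 𝓘(ℝ, ℝ) s f) (X : GroupLieAlgebra (𝓡 n) G) :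
    ContMDiff (𝓡 n) 𝓘(ℝ, ℝ) r (lieDeriv X f) := by
  have hrs' : (r : WithTop ℕ∞) + 1 ≤ s := by exact_mod_cast hrs
  have hs : (s : WithTop ℕ∞) ≠ 0 := (zero_lt_one.trans_le (le_add_self.trans hrs')).ne'
  intro g₀
  have hmul : ContMDiff ((𝓡 n).prod (𝓡 n)) (𝓡 n) s fun p : G × G => p.1 * p.2 :=
    (contMDiff_mul (𝓡 n) ∞).of_le (WithTop.coe_le_coe.mpr le_top)
  exact (contMDiffAt_coordDeriv (f := fun g x => f (g * x)) (x₀ := 1) hrs'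
    (hf.comp hmul).contMDiffAt X).congr_of_eventuallyEq
    (Eventually.of_forall fun g => lieDeriv_eq_coordDeriv (hf.mdifferentiable hs g) X)

theorem eq_of_lieDeriv_eq_zero [PreconnectedSpace G] {f : G → ℝ}
    (hf : MDifferentiable (𝓡 n) 𝓘(ℝ, ℝ) f)
    (h₀ : ∀ (X : GroupLieAlgebra (𝓡 n) G) (g : G), lieDeriv X f g = 0) (x y : G) : f x = f y := by
  refine IsLocallyConstant.apply_eq_of_preconnectedSpace
    (isLocallyConstant_of_coordDeriv_eq_zero hf fun g v => ?_) x y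
  have e := coordDeriv_comp (I := 𝓡 n) (f := fun k : G => g⁻¹ * k) (g := fun k => f (g * k))
    (x := g) (inv_mul_cancel g) ((hf.comp (mdifferentiable_mul_left g)) 1)
    (mdifferentiable_mul_left g⁻¹ g) v
  simp only [mul_inv_cancel_left] at e
  rw [e]
  exact (lieDeriv_eq_coordDeriv (hf g) _).symm.trans (h₀ _ g)

end LieDerivative

section Haar

theorem isMulRightInvariant_of_compactSpace {K : Type*} [TopologicalSpace K] [Group K]
    [IsTopologicalGroup K] [CompactSpace K] [MeasurableSpace K] [BorelSpace K] (μ : Measure K)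
    [μ.IsHaarMeasure] : μ.IsMulRightInvariant := by
  refine ⟨fun g => ?_⟩
  have hg : Measurable (· * g) := (continuous_mul_const g).measurable
  have h := Measure.isMulInvariant_eq_smul_of_compactSpace (μ.map (· * g)) μ
  have h₁ := congrArg (fun ν : Measure K => ν Set.univ) h
  simp only [Measure.map_apply hg MeasurableSet.univ, Set.preimage_univ, Measure.smul_apply,
    ENNReal.smul_def, smul_eq_mul] at h₁
  rw [h, ENNReal.coe_eq_one.1 ((ENNReal.mul_eq_right (NeZero.ne _) (measure_ne_top _ _)).1 h₁.symm),
    one_smul]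

theorem integrable_of_compactSpace {K : Type*} [TopologicalSpace K] [CompactSpace K]
    [MeasurableSpace K] [OpensMeasurableSpace K] {μ : Measure K} [IsFiniteMeasureOnCompacts μ]
    {f : K → ℝ} (hf : Continuous f) : Integrable f μ :=
  hf.integrable_of_hasCompactSupport (.of_compactSpace f)

variable {p : ℕ} {K : Type*} [TopologicalSpace K] [Group K]
  [ChartedSpace (EuclideanSpace ℝ (Fin p)) K] [LieGroup (𝓡 p) ∞ K] [CompactSpace K]
  [MeasurableSpace K] [BorelSpace K] (μ : Measure K) [μ.IsHaarMeasure]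

/-- The flow of a left-invariant vector field consists of right translations, which preserve the
measure. -/
theorem integral_lieDeriv_eq_zero {f : K → ℝ} (hf : ContMDiff (𝓡 p) 𝓘(ℝ, ℝ) 1 f)
    (X : GroupLieAlgebra (𝓡 p) K) : ∫ h, lieDeriv X f h ∂μ = 0 := by
  have : IsTopologicalGroup K := topologicalGroup_of_lieGroup (𝓡 p) ∞
  have := isMulRightInvariant_of_compactSpace μ
  have hfd := hf.mdifferentiable one_ne_zero
  have hXf : Continuous (lieDeriv X f) := (contMDiff_lieDeriv (r := 0) le_rfl hf X).continuous
  obtain ⟨C, hC⟩ := isCompact_univ.exists_bound_of_continuousOn hXf.continuousOn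
  obtain ⟨γ, -, hγ⟩ := exists_isMIntegralCurveAt_of_contMDiffAt_boundaryless (I := 𝓡 p) 0
    ((contMDiffAt_mulInvariantVectorField (G := K) X (g := 1)).of_le
      (one_le_two.trans le_minSmoothness))
  obtain ⟨s, hs, hγs⟩ := eventually_iff_exists_mem.1 hγ
  have hderiv (h : K) (t : ℝ) (ht : t ∈ s) :
      HasDerivAt (fun t => f (h * γ t)) (lieDeriv X f (h * γ t)) t := by
    rw [← lieDeriv_comp_mul_left hfd]
    exact hasDerivAt_comp_of_hasMFDerivAt ((hfd.comp (mdifferentiable_mul_left h)) _) (hγs t ht)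
  have hint {u : K → ℝ} (hu : Continuous u) (t : ℝ) : Integrable (fun h => u (h * γ t)) μ :=
    integrable_of_compactSpace (hu.comp (continuous_mul_const _))
  have key := (hasDerivAt_integral_of_dominated_loc_of_deriv_le (μ := μ) hs
    (Eventually.of_forall fun t => (hint hf.continuous t).aestronglyMeasurable)
    (hint hf.continuous 0) (hint hXf 0).aestronglyMeasurable
    (Eventually.of_forall fun h t _ => hC (h * γ t) (Set.mem_univ _)) (integrable_const C)
    (Eventually.of_forall fun h t ht => hderiv h t ht)).2
  simp only [integral_mul_right_eq_self] at key
  exact key.unique (hasDerivAt_const 0 _)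

theorem integral_lieDeriv_mul {u v : K → ℝ} (hu : ContMDiff (𝓡 p) 𝓘(ℝ, ℝ) 1 u)
    (hv : ContMDiff (𝓡 p) 𝓘(ℝ, ℝ) 1 v) (X : GroupLieAlgebra (𝓡 p) K) :
    ∫ h, lieDeriv X u h * v h ∂μ = -∫ h, u h * lieDeriv X v h ∂μ := by
  have hXu : Continuous (lieDeriv X u) := (contMDiff_lieDeriv (r := 0) le_rfl hu X).continuous
  have hXv : Continuous (lieDeriv X v) := (contMDiff_lieDeriv (r := 0) le_rfl hv X).continuous
  have h := integral_lieDeriv_eq_zero μ (hu.mul hv) X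
  have leibniz : lieDeriv X (u * v) = u * lieDeriv X v + lieDeriv X u * v := by
    ext x
    exact (lieDeriv_mul (hu.mdifferentiable one_ne_zero x) (hv.mdifferentiable one_ne_zero x)
      X).trans (congrArg _ (mul_comm _ _))
  rw [leibniz, integral_add' (integrable_of_compactSpace (hu.continuous.mul hXv))
    (integrable_of_compactSpace (hXu.mul hv.continuous))] at h
  exact eq_neg_of_add_eq_zero_right h

theorem integral_sumSquares_mul {N : ℕ} (A : Fin N → GroupLieAlgebra (𝓡 p) K) {u v : K → ℝ}
    (hu : ContMDiff (𝓡 p) 𝓘(ℝ, ℝ) 2 u) (hv : ContMDiff (𝓡 p) 𝓘(ℝ, ℝ) 2 v) :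
    ∫ h, sumSquares A u h * v h ∂μ = ∫ h, u h * sumSquares A v h ∂μ := by
  have hL {w : K → ℝ} (hw : ContMDiff (𝓡 p) 𝓘(ℝ, ℝ) 2 w) (X : GroupLieAlgebra (𝓡 p) K) :
      ContMDiff (𝓡 p) 𝓘(ℝ, ℝ) 1 (lieDeriv X w) :=
    contMDiff_lieDeriv (r := 1) (s := 2) one_add_one_eq_two.le hw X
  have hLL {w : K → ℝ} (hw : ContMDiff (𝓡 p) 𝓘(ℝ, ℝ) 2 w) (X : GroupLieAlgebra (𝓡 p) K) :
      Continuous (lieDeriv X (lieDeriv X w)) :=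
    (contMDiff_lieDeriv (r := 0) le_rfl (hL hw X) X).continuous
  have hu' k : Integrable (fun h => lieDeriv (A k) (lieDeriv (A k) u) h * v h) μ :=
    integrable_of_compactSpace ((hLL hu _).mul hv.continuous)
  have hv' k : Integrable (fun h => u h * lieDeriv (A k) (lieDeriv (A k) v) h) μ :=
    integrable_of_compactSpace (hu.continuous.mul (hLL hv _))
  simp only [sumSquares, Finset.sum_mul, Finset.mul_sum]
  rw [integral_finsetSum _ fun k _ => hu' k, integral_finsetSum _ fun k _ => hv' k]
  refine Finset.sum_congr rfl fun k _ => ?_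
  rw [integral_lieDeriv_mul μ (hL hu _) (hv.of_le one_le_two),
    integral_lieDeriv_mul μ (hu.of_le one_le_two) (hL hv _), neg_neg]

end Haar

section CasimirOperator

variable {E : Type*} [AddCommGroup E] [Module ℝ E] {N : ℕ} {B : LinearMap.BilinForm ℝ E}

/-- The operator `-(1/2) ∑ k, (T k)²`; for `T k = ad (A k)` it is the Casimir operator of the
family `A`. -/
noncomputable def casimirOperator (T : Fin N → Module.End ℝ E) : Module.End ℝ E :=
  -((1 / 2 : ℝ) • ∑ k, T k * T k)

variable {T : Fin N → Module.End ℝ E}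

theorem casimirOperator_apply (T : Fin N → Module.End ℝ E) (X : E) :
    casimirOperator T X = -((1 / 2 : ℝ) • ∑ k, T k (T k X)) := by
  simp [casimirOperator]

theorem casimirOperator_apply_mem {V : Submodule ℝ E} (hT : ∀ k, ∀ X ∈ V, T k X ∈ V) {X : E}
    (hX : X ∈ V) : casimirOperator T X ∈ V := by
  rw [casimirOperator_apply]
  exact V.neg_mem (V.smul_mem _ (V.sum_mem fun k _ => hT k _ (hT k X hX)))

theorem apply_casimirOperator_of_skew (hT : ∀ k X Y, B (T k X) Y = -B X (T k Y)) (X Y : E) :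
    B (casimirOperator T X) Y = (1 / 2) * ∑ k, B (T k X) (T k Y) := by
  simp [casimirOperator_apply, hT _ (T _ X)]

theorem apply_casimirOperator_self_pos (hB : ∀ X, X ≠ 0 → 0 < B X X)
    (hT : ∀ k X Y, B (T k X) Y = -B X (T k Y)) {X : E} (hX : ∃ k, T k X ≠ 0) :
    0 < B (casimirOperator T X) X := by
  rw [apply_casimirOperator_of_skew hT]
  have hnonneg k : 0 ≤ B (T k X) (T k X) := by
    rcases eq_or_ne (T k X) 0 with h | h
    · simp [h]
    · exact (hB _ h).le
  obtain ⟨k, hk⟩ := hX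
  exact mul_pos one_half_pos
    (Finset.sum_pos' (fun k _ => hnonneg k) ⟨k, Finset.mem_univ k, hB _ hk⟩)

theorem exists_apply_eq_of_apply_self_pos {V : Submodule ℝ E} [FiniteDimensional ℝ V]
    {C : Module.End ℝ E} (hC : ∀ X ∈ V, C X ∈ V) (hpos : ∀ X ∈ V, X ≠ 0 → 0 < B (C X) X) {Y : E}
    (hY : Y ∈ V) : ∃ X ∈ V, C X = Y := by
  have hinj : Function.Injective (C.restrict hC) := by
    rw [injective_iff_map_eq_zero]
    intro X hX
    by_contra hne
    have hCX : C X = 0 := congrArg Subtype.val hX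
    simpa [hCX] using hpos X X.2 (by simpa using hne)
  obtain ⟨X, hX⟩ := LinearMap.injective_iff_surjective.1 hinj ⟨Y, hY⟩
  exact ⟨X, X.2, congrArg Subtype.val hX⟩

theorem apply_sum_div_smul_of_apply_eq_smul {C : Module.End ℝ E} {ι : Type*} (s : Finset ι)
    {Y : ι → E} {lam : ι → ℝ} (hlam : ∀ m, lam m ≠ 0) (hC : ∀ m, C (Y m) = lam m • Y m)
    (c : ι → ℝ) : C (∑ m ∈ s, (c m / lam m) • Y m) = ∑ m ∈ s, c m • Y m := by
  simp [hC, smul_smul, div_mul_cancel₀ _ (hlam _)]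

end CasimirOperator

section Correlation

variable {K E : Type*} [TopologicalSpace K] [Group K] [CompactSpace K] [MeasurableSpace K]
  [BorelSpace K] (μ : Measure K) [IsFiniteMeasureOnCompacts μ] [AddCommGroup E] [Module ℝ E]
  {ρ : Representation ℝ K E} {B : LinearMap.BilinForm ℝ E}

theorem integrable_matrixCoeff_mul
    (hρ : ∀ (l : Module.Dual ℝ E) (X : E), Continuous fun k => l (ρ k X))
    (B : LinearMap.BilinForm ℝ E) (X Y Z Z' : E) :
    Integrable (fun k => B (ρ k X) Z * B (ρ k Y) Z') μ :=
  integrable_of_compactSpace ((hρ (B.flip Z) X).mul (hρ (B.flip Z') Y))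

/-- The integral `∫ ⟨ρ(k) X, Z⟩ ⟨ρ(k) Y, Z'⟩ dk` of a product of matrix coefficients of the
representation `ρ`, as a bilinear form in `Z` and `Z'`. -/
noncomputable def correlation
    (hρ : ∀ (l : Module.Dual ℝ E) (X : E), Continuous fun k => l (ρ k X))
    (B : LinearMap.BilinForm ℝ E) (X Y : E) : LinearMap.BilinForm ℝ E :=
  LinearMap.mk₂ ℝ (fun Z Z' => ∫ k, B (ρ k X) Z * B (ρ k Y) Z' ∂μ)
    (fun Z₁ Z₂ Z' => by
      simp only [map_add, add_mul]
      exact integral_add (integrable_matrixCoeff_mul μ hρ B X Y Z₁ Z')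
        (integrable_matrixCoeff_mul μ hρ B X Y Z₂ Z'))
    (fun c Z Z' => by simp only [map_smul, smul_eq_mul, mul_assoc, integral_const_mul])
    (fun Z Z₁ Z₂ => by
      simp only [map_add, mul_add]
      exact integral_add (integrable_matrixCoeff_mul μ hρ B X Y Z Z₁)
        (integrable_matrixCoeff_mul μ hρ B X Y Z Z₂))
    (fun c Z Z' => by simp only [map_smul, smul_eq_mul, mul_left_comm, integral_const_mul])

variable {μ} {hρ : ∀ (l : Module.Dual ℝ E) (X : E), Continuous fun k => l (ρ k X)}

theorem correlation_apply (X Y Z Z' : E) :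
    correlation μ hρ B X Y Z Z' = ∫ k, B (ρ k X) Z * B (ρ k Y) Z' ∂μ := rfl

theorem correlation_apply_apply [IsTopologicalGroup K] [μ.IsMulLeftInvariant]
    (hB : ∀ k X X', B (ρ k X) (ρ k X') = B X X') (k : K) (X Y Z Z' : E) :
    correlation μ hρ B X Y (ρ k Z) (ρ k Z') = correlation μ hρ B X Y Z Z' := by
  have translate X Z h : B (ρ h X) (ρ k Z) = B (ρ (k⁻¹ * h) X) Z := by
    rw [← hB k (ρ (k⁻¹ * h) X), ← Module.End.mul_apply, ← map_mul, mul_inv_cancel_left]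
  simp only [correlation_apply, translate]
  exact integral_mul_left_eq_self (fun h => B (ρ h X) Z * B (ρ h Y) Z') k⁻¹

variable {ι : Type*} [Fintype ι] [DecidableEq ι] {V : Submodule ℝ E} {W : ι → E}

theorem sum_correlation_apply_self [IsProbabilityMeasure μ]
    (hB : ∀ k X X', B (ρ k X) (ρ k X') = B X X') (hsymm : ∀ X X', B X X' = B X' X)
    (hV : ∀ k, ∀ X ∈ V, ρ k X ∈ V) (hW : IsOrthonormalFamily B W)
    (hWV : Submodule.span ℝ (Set.range W) = V) {X : E} (hX : X ∈ V) (Y : E) :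
    ∑ m, correlation μ hρ B X Y (W m) (W m) = B X Y := by
  have parseval k : ∑ m, B (ρ k X) (W m) * B (ρ k Y) (W m) = B X Y := by
    simp only [hsymm (ρ k Y)]
    rw [← hB k, hW.apply_eq_sum (hWV ▸ hV k X hX)]
  simp only [correlation_apply]
  rw [← integral_finsetSum _ fun m _ => integrable_matrixCoeff_mul μ hρ B X Y (W m) (W m)]
  simp [parseval]

theorem correlation_apply_proj (hV : ∀ k, ∀ X ∈ V, ρ k X ∈ V) (hW : IsOrthonormalFamily B W)
    (hWV : Submodule.span ℝ (Set.range W) = V) {X Y : E} (hX : X ∈ V) (hY : Y ∈ V) (Z Z' : E) :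
    correlation μ hρ B X Y (∑ m, B (W m) Z • W m) (∑ m, B (W m) Z' • W m)
      = correlation μ hρ B X Y Z Z' := by
  have proj {X : E} (hX : X ∈ V) (Z : E) (k : K) :
      B (ρ k X) (∑ m, B (W m) Z • W m) = B (ρ k X) Z := by
    rw [hW.apply_eq_sum (hWV ▸ hV k X hX) Z]
    simp [mul_comm]
  simp only [correlation_apply, proj hX, proj hY]

/-- Schur's lemma determines the correlation up to a factor, which is read off its trace. -/
theorem IsIrreducibleSubspace.correlation_apply_eq [IsTopologicalGroup K] [μ.IsMulLeftInvariant]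
    [IsProbabilityMeasure μ] (hV : IsIrreducibleSubspace ρ V)
    (hB : ∀ k X X', B (ρ k X) (ρ k X') = B X X') (hsymm : ∀ X X', B X X' = B X' X)
    (hW : IsOrthonormalFamily B W) (hWV : Submodule.span ℝ (Set.range W) = V) {X Y : E}
    (hX : X ∈ V) (hY : Y ∈ V)
    (hXY : ∀ Z Z', correlation μ hρ B X Y Z Z' = correlation μ hρ B X Y Z' Z) (Z Z' : E) :
    correlation μ hρ B X Y Z Z'
      = B X Y / Module.finrank ℝ V * ∑ m, B (W m) Z * B (W m) Z' := by
  have hmem m : W m ∈ V := hWV ▸ Submodule.subset_span ⟨m, rfl⟩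
  obtain ⟨κ, hκ⟩ := hV.exists_apply_eq_mul hB hW hWV (S := correlation μ hρ B X Y)
    (fun Z _ Z' _ => hXY Z Z') fun k Z _ Z' _ => correlation_apply_apply hB k X Y Z Z'
  have hrank : Module.finrank ℝ V = Fintype.card ι := hWV ▸ hW.finrank_span
  have htrace : B X Y = κ * Module.finrank ℝ V := by
    rw [← sum_correlation_apply_self (μ := μ) (hρ := hρ) hB hsymm hV.invariant hW hWV hX Y, hrank]
    simp [hκ _ (hmem _) _ (hmem _), hW _ _, mul_comm]
  have hdim : (Module.finrank ℝ V : ℝ) ≠ 0 := by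
    have : FiniteDimensional ℝ V := hWV ▸ .span_of_finite ℝ (Set.finite_range W)
    exact Nat.cast_ne_zero.2 (mt Submodule.finrank_eq_zero.1 hV.ne_bot)
  rw [htrace, mul_div_cancel_right₀ _ hdim, ← hW.apply_sum_sum,
    ← correlation_apply_proj hV.invariant hW hWV hX hY]
  exact hκ _ (V.sum_mem fun m _ => V.smul_mem _ (hmem m)) _
    (V.sum_mem fun m _ => V.smul_mem _ (hmem m))

end Correlation

section Differential

variable {p : ℕ} {K E : Type*} [TopologicalSpace K] [Group K]
  [ChartedSpace (EuclideanSpace ℝ (Fin p)) K] [AddCommGroup E] [Module ℝ E]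

/-- The representation `ρ` of the Lie group `K` is smooth and `σ` is its differential. Smoothness
and derivatives are those of the matrix coefficients, so that `E` needs no topology. -/
structure HasDifferential (ρ : Representation ℝ K E)
    (σ : GroupLieAlgebra (𝓡 p) K → Module.End ℝ E) : Prop where
  contMDiff : ∀ (l : Module.Dual ℝ E) (X : E), ContMDiff (𝓡 p) 𝓘(ℝ, ℝ) ∞ fun k => l (ρ k X)
  lieDeriv_eq : ∀ (l : Module.Dual ℝ E) (A : GroupLieAlgebra (𝓡 p) K) (X : E),
    lieDeriv A (fun k => l (ρ k X)) = fun k => l (ρ k (σ A X))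

namespace HasDifferential

variable {ρ : Representation ℝ K E} {σ : GroupLieAlgebra (𝓡 p) K → Module.End ℝ E}
  {B : LinearMap.BilinForm ℝ E} {N : ℕ}

theorem continuous (hσ : HasDifferential ρ σ) (l : Module.Dual ℝ E) (X : E) :
    Continuous fun k => l (ρ k X) :=
  (hσ.contMDiff l X).continuous

theorem mdifferentiable (hσ : HasDifferential ρ σ) (l : Module.Dual ℝ E) (X : E) :
    MDifferentiable (𝓡 p) 𝓘(ℝ, ℝ) fun k => l (ρ k X) :=
  (hσ.contMDiff l X).mdifferentiable (by simp)

theorem apply_mem (hσ : HasDifferential ρ σ) {V : Submodule ℝ E}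
    (hV : ∀ k, ∀ X ∈ V, ρ k X ∈ V) (A : GroupLieAlgebra (𝓡 p) K) {X : E} (hX : X ∈ V) :
    σ A X ∈ V := by
  rw [← Subspace.forall_mem_dualAnnihilator_apply_eq_zero_iff V]
  intro l hl
  have hconst : (fun k => l (ρ k X)) = fun _ => 0 :=
    funext fun k => (Submodule.mem_dualAnnihilator l).1 hl _ (hV k X hX)
  simpa [hconst, lieDeriv_const] using (congrFun (hσ.lieDeriv_eq l A X) 1).symm

theorem lieDeriv_bilin [FiniteDimensional ℝ E] (hσ : HasDifferential ρ σ)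
    (B : LinearMap.BilinForm ℝ E) (A : GroupLieAlgebra (𝓡 p) K) (X Y : E) (k : K) :
    lieDeriv A (fun k => B (ρ k X) (ρ k Y)) k
      = B (ρ k (σ A X)) (ρ k Y) + B (ρ k X) (ρ k (σ A Y)) := by
  let b := Module.finBasis ℝ E
  have expand U W : B U W = ∑ i, 1 * (b.coord i U * B (b i) W) := by
    conv_lhs => rw [← b.sum_repr U]
    simp only [map_sum, map_smul, LinearMap.sum_apply, LinearMap.smul_apply, smul_eq_mul,
      one_mul, Module.Basis.coord_apply]
  simp only [expand (ρ _ _)]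
  rw [lieDeriv_sum_mul (f := fun i k => b.coord i (ρ k X) * B (b i) (ρ k Y)) _ _ fun i =>
    (hσ.mdifferentiable (b.coord i) X k).mul (hσ.mdifferentiable (B (b i)) Y k),
    ← Finset.sum_add_distrib]
  refine Finset.sum_congr rfl fun i _ => ?_
  rw [lieDeriv_mul (hσ.mdifferentiable (b.coord i) X k) (hσ.mdifferentiable (B (b i)) Y k),
    hσ.lieDeriv_eq, hσ.lieDeriv_eq]
  ring

theorem apply_eq_neg_of_invariant [FiniteDimensional ℝ E] (hσ : HasDifferential ρ σ)
    (hB : ∀ k X X', B (ρ k X) (ρ k X') = B X X') (A : GroupLieAlgebra (𝓡 p) K) (X Y : E) :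
    B (σ A X) Y = -B X (σ A Y) := by
  have h := hσ.lieDeriv_bilin B A X Y 1
  simp only [hB, lieDeriv_const] at h
  exact eq_neg_of_add_eq_zero_left h.symm

theorem apply_eq_self [LieGroup (𝓡 p) ∞ K] [PreconnectedSpace K] (hσ : HasDifferential ρ σ)
    {X : E} (hX : ∀ A, σ A X = 0) (k : K) : ρ k X = X := by
  rw [← sub_eq_zero, ← Module.forall_dual_apply_eq_zero_iff ℝ]
  intro l
  rw [map_sub, sub_eq_zero]
  simpa using eq_of_lieDeriv_eq_zero (hσ.mdifferentiable l X)
    (fun A h => by simp [hσ.lieDeriv_eq, hX]) k 1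

theorem half_sumSquares (hσ : HasDifferential ρ σ) (A : Fin N → GroupLieAlgebra (𝓡 p) K)
    (l : Module.Dual ℝ E) (X : E) (k : K) :
    (1 / 2) * sumSquares A (fun k => l (ρ k X)) k
      = -l (ρ k (casimirOperator (fun i => σ (A i)) X)) := by
  simp only [sumSquares, hσ.lieDeriv_eq]
  simp [casimirOperator_apply]

theorem contMDiff_bilin (hσ : HasDifferential ρ σ) (B : LinearMap.BilinForm ℝ E) (X Z : E) :
    ContMDiff (𝓡 p) 𝓘(ℝ, ℝ) 2 fun k => B (ρ k X) Z :=
  (hσ.contMDiff (B.flip Z) X).of_le (WithTop.coe_le_coe.mpr le_top)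

theorem bilin_casimirOperator (hσ : HasDifferential ρ σ)
    (A : Fin N → GroupLieAlgebra (𝓡 p) K) (B : LinearMap.BilinForm ℝ E) (X Z : E) (k : K) :
    B (ρ k (casimirOperator (fun i => σ (A i)) X)) Z
      = -(1 / 2) * sumSquares A (fun k => B (ρ k X) Z) k := by
  have h := hσ.half_sumSquares A (B.flip Z) X k
  simp only [LinearMap.BilinForm.flip_apply] at h
  rw [neg_mul, h, neg_neg]

section Integral

variable [LieGroup (𝓡 p) ∞ K] [CompactSpace K] [MeasurableSpace K] [BorelSpace K] (μ : Measure K)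
  [μ.IsHaarMeasure]

theorem correlation_casimirOperator_comm (hσ : HasDifferential ρ σ)
    (A : Fin N → GroupLieAlgebra (𝓡 p) K) (X Z Z' : E) :
    correlation μ hσ.continuous B X (casimirOperator (fun i => σ (A i)) X) Z Z'
      = correlation μ hσ.continuous B X (casimirOperator (fun i => σ (A i)) X) Z' Z := by
  simp only [correlation_apply, hσ.bilin_casimirOperator,
    mul_left_comm _ (-(1 / 2) : ℝ), integral_const_mul]
  rw [← integral_sumSquares_mul μ A (hσ.contMDiff_bilin B X Z) (hσ.contMDiff_bilin B X Z')]
  simp only [mul_comm]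

theorem neg_integral_matrixCoeff_mul (hσ : HasDifferential ρ σ)
    {A : Fin N → GroupLieAlgebra (𝓡 p) K} {X Z Z' : E} {β : K → ℝ}
    (hβ : ContMDiff (𝓡 p) 𝓘(ℝ, ℝ) 2 β)
    (hβX : ∀ k, (1 / 2) * sumSquares A β k
      = B (ρ k (casimirOperator (fun i => σ (A i)) X)) Z') :
    -∫ k, B (ρ k (casimirOperator (fun i => σ (A i)) X)) Z * β k ∂μ
      = correlation μ hσ.continuous B X (casimirOperator (fun i => σ (A i)) X) Z Z' := by
  simp only [correlation_apply, ← hβX, hσ.bilin_casimirOperator A B X Z, mul_assoc,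
    mul_left_comm _ (1 / 2 : ℝ), integral_const_mul]
  rw [integral_sumSquares_mul μ A (hσ.contMDiff_bilin B X Z) hβ]
  ring

end Integral

end HasDifferential

end Differential

section Subspaces

variable {n : ℕ} {G : Type*} [TopologicalSpace G] [Group G]
  [ChartedSpace (EuclideanSpace ℝ (Fin n)) G] {B : LinearMap.BilinForm ℝ (GroupLieAlgebra (𝓡 n) G)}

theorem IsOrthonormalBasisOf.mem {V : Submodule ℝ (GroupLieAlgebra (𝓡 n) G)} {d : ℕ}
    {W : Fin d → GroupLieAlgebra (𝓡 n) G} (hW : IsOrthonormalBasisOf B V W) (m : Fin d) : W m ∈ V :=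
  hW.span_eq ▸ Submodule.subset_span ⟨m, rfl⟩

theorem IsIrreducibleDecomposition.eq_zero_of_forall_Ad_eq_self {p : ℕ} {H : Subgroup G}
    [ChartedSpace (EuclideanSpace ℝ (Fin p)) H] {r : ℕ}
    {𝔪 : Fin (r + 1) → Submodule ℝ (GroupLieAlgebra (𝓡 n) G)}
    (h𝔪 : IsIrreducibleDecomposition p H B 𝔪) (hB : ∀ X, X ≠ 0 → 0 < B X X) {l : Fin (r + 1)}
    (hl : l ≠ 0) {X : GroupLieAlgebra (𝓡 n) G} (hX : X ∈ 𝔪 l) (hfix : ∀ h ∈ H, Ad n h X = X) :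
    X = 0 := by
  have hX₀ : X ∈ 𝔪 0 := (h𝔪.mem_zero_iff X).2 ⟨h𝔪.iSup_eq ▸ Submodule.mem_iSup_of_mem l hX, hfix⟩
  by_contra hne
  exact (hB X hne).ne' (h𝔪.orthogonal l 0 hl X hX X hX₀)

end Subspaces

section SumSquares

variable {n : ℕ} {G : Type*} [TopologicalSpace G] [Group G]
  [ChartedSpace (EuclideanSpace ℝ (Fin n)) G] [LieGroup (𝓡 n) ∞ G]
  {B : LinearMap.BilinForm ℝ (GroupLieAlgebra (𝓡 n) G)}

theorem sumSquares_eq_of_orthonormal {ι : Type*} [Fintype ι] [DecidableEq ι] {d : ℕ}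
    {W : Fin d → GroupLieAlgebra (𝓡 n) G} {Z : ι → GroupLieAlgebra (𝓡 n) G}
    (hZ : IsOrthonormalFamily B Z) (hWZ : ∀ m, W m ∈ Submodule.span ℝ (Set.range Z)) {f : G → ℝ}
    (hf : ContMDiff (𝓡 n) 𝓘(ℝ, ℝ) 2 f) (g : G) :
    sumSquares W f g = ∑ i, ∑ j, (∑ m, B (W m) (Z i) * B (W m) (Z j)) *
      lieDeriv (Z i) (lieDeriv (Z j) f) g := by
  have expand m f g : lieDeriv (W m) f g = ∑ i, B (W m) (Z i) * lieDeriv (Z i) f g := by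
    conv_lhs => rw [hZ.eq_sum (hWZ m)]
    rw [lieDeriv_sum_left]
  have hdiff j : MDifferentiableAt (𝓡 n) 𝓘(ℝ, ℝ) (lieDeriv (Z j) f) g :=
    (contMDiff_lieDeriv (r := 1) (s := 2) (by norm_num) hf (Z j)).mdifferentiable (by simp) g
  calc sumSquares W f g
      = ∑ m, ∑ i, ∑ j, B (W m) (Z i) * B (W m) (Z j) * lieDeriv (Z i) (lieDeriv (Z j) f) g := by
        refine Finset.sum_congr rfl fun m _ => (expand m _ g).trans ?_
        refine Finset.sum_congr rfl fun i _ => ?_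
        rw [funext (expand m f), lieDeriv_sum_mul _ _ hdiff, Finset.mul_sum]
        simp only [mul_assoc]
    _ = _ := by
        rw [Finset.sum_comm]
        refine Finset.sum_congr rfl fun i _ => ?_
        rw [Finset.sum_comm]
        simp only [Finset.sum_mul]

end SumSquares

theorem lie_eq_zero_of_mem_lieSpan {R L M : Type*} [CommRing R] [LieRing L] [LieAlgebra R L]
    [AddCommGroup M] [Module R M] [LieRingModule L M] [LieModule R L M] {s : Set L} {m : M}
    (hs : ∀ x ∈ s, ⁅x, m⁆ = 0) {x : L} (hx : x ∈ LieSubalgebra.lieSpan R L s) : ⁅x, m⁆ = 0 := by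
  induction hx using LieSubalgebra.lieSpan_induction with
  | mem x hx => exact hs x hx
  | zero => exact zero_lie m
  | add x y _ _ hx hy => rw [add_lie, hx, hy, add_zero]
  | smul c x _ hx => rw [smul_lie, hx, smul_zero]
  | lie x y _ _ hx hy => rw [lie_lie, hx, hy, lie_zero, lie_zero, sub_zero]

section Subgroup

variable {n p : ℕ} {G : Type*} [TopologicalSpace G] [Group G]
  [ChartedSpace (EuclideanSpace ℝ (Fin n)) G] [LieGroup (𝓡 n) ∞ G]
  {H : Subgroup G} [ChartedSpace (EuclideanSpace ℝ (Fin p)) H]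
  {B : LinearMap.BilinForm ℝ (GroupLieAlgebra (𝓡 n) G)}
  {N : ℕ} {A : Fin N → GroupLieAlgebra (𝓡 p) H}
  {U : Submodule ℝ (GroupLieAlgebra (𝓡 n) G)} {d : ℕ} {W : Fin d → GroupLieAlgebra (𝓡 n) G}

instance finiteDimensional_groupLieAlgebra : FiniteDimensional ℝ (GroupLieAlgebra (𝓡 n) G) :=
  inferInstanceAs (FiniteDimensional ℝ (EuclideanSpace ℝ (Fin n)))

variable (n H) in
/-- The adjoint action of the subgroup `H` on the Lie algebra of `G`, as a representation. -/
noncomputable def subgroupAdRep : Representation ℝ H (GroupLieAlgebra (𝓡 n) G) :=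
  (adRep n G).comp H.subtype

variable (n) in
/-- The adjoint action of the Lie algebra of the subgroup `H` on the Lie algebra of `G`. It is the
differential of `subgroupAdRep n H`. -/
noncomputable def subLieAd (A : GroupLieAlgebra (𝓡 p) H) :
    Module.End ℝ (GroupLieAlgebra (𝓡 n) G) :=
  LieAlgebra.ad ℝ _ (inclLie n p H A)

theorem subLieAd_apply (A : GroupLieAlgebra (𝓡 p) H) (X : GroupLieAlgebra (𝓡 n) G) :
    subLieAd n A X = ⁅inclLie n p H A, X⁆ := rfl

theorem casimir_inclLie (A : Fin N → GroupLieAlgebra (𝓡 p) H) (X : GroupLieAlgebra (𝓡 n) G) :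
    casimir (fun k => inclLie n p H (A k)) X = casimirOperator (fun k => subLieAd n (A k)) X := by
  simp only [casimir, casimirOperator_apply, subLieAd_apply]

theorem IsInvariantInnerProduct.apply_subgroupAdRep (hB : IsInvariantInnerProduct H B) (h : H)
    (X X' : GroupLieAlgebra (𝓡 n) G) :
    B (subgroupAdRep n H h X) (subgroupAdRep n H h X') = B X X' :=
  hB.invariant h h.2 X X'

theorem IsAdIrreducible.isIrreducibleSubspace (hU : IsAdIrreducible H U) :
    IsIrreducibleSubspace (subgroupAdRep n H) U where
  invariant h := hU.invariant h h.2
  ne_bot := hU.ne_bot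
  eq_bot_or_eq V hVU hV := hU.eq_bot_or_eq V hVU fun h hh => hV ⟨h, hh⟩

theorem lie_eq_zero_of_isLieGenerating (hA : IsLieGenerating (n := n) H A)
    {Y : GroupLieAlgebra (𝓡 n) G} (hY : ∀ k, ⁅inclLie n p H (A k), Y⁆ = 0)
    (A' : GroupLieAlgebra (𝓡 p) H) : ⁅inclLie n p H A', Y⁆ = 0 :=
  lie_eq_zero_of_mem_lieSpan (by simpa using hY) ((hA _).2 ⟨A', rfl⟩)

variable [LieGroup (𝓡 p) ∞ H]

theorem hasDifferential_subgroupAdRep (hH : ContMDiff (𝓡 p) (𝓡 n) ∞ (Subtype.val : H → G)) :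
    HasDifferential (subgroupAdRep n H) (subLieAd (p := p) n) := by
  have smooth (l : EuclideanSpace ℝ (Fin n) →ₗ[ℝ] ℝ) (X : EuclideanSpace ℝ (Fin n)) :
      ContMDiff (𝓡 n) 𝓘(ℝ, ℝ) ∞ fun g : G => l (coordAd n g X) :=
    l.toContinuousLinearMap.contDiff.contMDiff.comp (contMDiff_coordAd_apply X)
  have hsmooth (l : Module.Dual ℝ (GroupLieAlgebra (𝓡 n) G)) (X : GroupLieAlgebra (𝓡 n) G) :
      ContMDiff (𝓡 p) 𝓘(ℝ, ℝ) ∞ fun h => l (subgroupAdRep n H h X) :=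
    (smooth l X).comp hH
  refine ⟨hsmooth, fun l A X => funext fun h => ?_⟩
  let l' : EuclideanSpace ℝ (Fin n) →ₗ[ℝ] ℝ := l ∘ₗ Ad n (h : G)
  let L : EuclideanSpace ℝ (Fin n) →L[ℝ] ℝ := l'.toContinuousLinearMap
  calc lieDeriv A (fun k => l (subgroupAdRep n H k X)) h
      = coordDeriv (𝓡 p) 𝓘(ℝ, ℝ) (fun k => l (subgroupAdRep n H (h * k) X)) 1 A :=
        lieDeriv_eq_coordDeriv ((hsmooth l X).mdifferentiable (by simp) h) A
    _ = coordDeriv (𝓡 p) 𝓘(ℝ, ℝ) (fun k : H => l' (coordAd n (k : G) X)) 1 A := by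
        simp only [map_mul]
        rfl
    _ = coordDeriv (𝓡 n) 𝓘(ℝ, ℝ) (fun g : G => l' (coordAd n g X)) 1 (inclLie n p H A) :=
        coordDeriv_comp (f := (Subtype.val : H → G)) rfl ((smooth l' X).mdifferentiable (by simp) 1)
          (hH.mdifferentiable (by simp) 1) A
    _ = l (subgroupAdRep n H h (subLieAd n A X)) :=
        coordDeriv_clm_coordAd_one L (inclLie n p H A) X

theorem Ad_inclLie (hH : ContMDiff (𝓡 p) (𝓡 n) ∞ (Subtype.val : H → G)) (h : H)
    (A : GroupLieAlgebra (𝓡 p) H) :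
    Ad n (h : G) (inclLie n p H A) = inclLie n p H (Ad p h A) := by
  have hval := hH.mdifferentiable (by simp)
  have conj_val := coordDeriv_comp (I := 𝓡 p) (I' := 𝓡 n) (I'' := 𝓡 n)
    (g := fun x : G => (h : G) * x * (h : G)⁻¹) (f := (Subtype.val : H → G)) rfl
    (mdifferentiable_conj (h : G) 1) (hval 1) A
  have val_conj := coordDeriv_comp (I := 𝓡 p) (I' := 𝓡 p) (I'' := 𝓡 n) (y := 1)
    (g := (Subtype.val : H → G)) (f := fun x : H => h * x * h⁻¹) (by simp) (hval 1)
    (mdifferentiable_conj h 1) A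
  exact conj_val.symm.trans val_conj

theorem bilin_casimir_self_pos [PreconnectedSpace H]
    (hH : ContMDiff (𝓡 p) (𝓡 n) ∞ (Subtype.val : H → G)) (hB : IsInvariantInnerProduct H B)
    (hA : IsLieGenerating (n := n) H A) {X : GroupLieAlgebra (𝓡 n) G}
    (hX : ¬∀ h ∈ H, Ad n h X = X) :
    0 < B (casimir (fun k => inclLie n p H (A k)) X) X := by
  have hσ := hasDifferential_subgroupAdRep hH
  rw [casimir_inclLie]
  refine apply_casimirOperator_self_pos hB.pos
    (fun k => hσ.apply_eq_neg_of_invariant hB.apply_subgroupAdRep (A k)) ?_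
  contrapose! hX
  exact fun h hh => hσ.apply_eq_self (lie_eq_zero_of_isLieGenerating hA hX) ⟨h, hh⟩

theorem pos_of_casimir_eq_smul [PreconnectedSpace H]
    (hH : ContMDiff (𝓡 p) (𝓡 n) ∞ (Subtype.val : H → G)) (hB : IsInvariantInnerProduct H B)
    (hA : IsLieGenerating (n := n) H A) {X : GroupLieAlgebra (𝓡 n) G}
    (hX : ¬∀ h ∈ H, Ad n h X = X) {κ : ℝ}
    (hκ : casimir (fun k => inclLie n p H (A k)) X = κ • X) : 0 < κ := by
  have hpos := bilin_casimir_self_pos hH hB hA hX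
  have hne : X ≠ 0 := by
    rintro rfl
    exact hX fun _ _ => map_zero _
  rw [hκ, LinearMap.map_smul₂, smul_eq_mul] at hpos
  exact pos_of_mul_pos_left hpos (hB.pos X hne).le

theorem casimir_mem (hH : ContMDiff (𝓡 p) (𝓡 n) ∞ (Subtype.val : H → G))
    (hU : IsAdInvariant H U) {X : GroupLieAlgebra (𝓡 n) G} (hX : X ∈ U) :
    casimir (fun k => inclLie n p H (A k)) X ∈ U := by
  rw [casimir_inclLie]
  exact casimirOperator_apply_mem
    (fun k _ => (hasDifferential_subgroupAdRep hH).apply_mem (fun h => hU h h.2) (A k)) hX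

theorem exists_casimir_eq (hH : ContMDiff (𝓡 p) (𝓡 n) ∞ (Subtype.val : H → G))
    (hU : IsAdInvariant H U)
    (hpos : ∀ X ∈ U, X ≠ 0 → 0 < B (casimir (fun k => inclLie n p H (A k)) X) X)
    {Y : GroupLieAlgebra (𝓡 n) G} (hY : Y ∈ U) :
    ∃ X ∈ U, casimir (fun k => inclLie n p H (A k)) X = Y := by
  have hmem X (hX : X ∈ U) := casimir_mem (A := A) hH hU hX
  simp only [casimir_inclLie] at hmem hpos ⊢
  exact exists_apply_eq_of_apply_self_pos hmem hpos hY

theorem isPoissonSolution_neg_coeff (hH : ContMDiff (𝓡 p) (𝓡 n) ∞ (Subtype.val : H → G))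
    (X Z : GroupLieAlgebra (𝓡 n) G) :
    IsPoissonSolution H A (coeff H B (casimir (fun k => inclLie n p H (A k)) X) Z)
      (fun h => -coeff H B X Z h) where
  smooth := (hasDifferential_subgroupAdRep hH).contMDiff (-B.flip Z) X
  eq h := by
    have e := (hasDifferential_subgroupAdRep hH).half_sumSquares A (-B.flip Z) X h
    rw [LinearMap.neg_apply, neg_neg, ← casimir_inclLie] at e
    exact e

theorem isOrthonormalBasisOf_inclLie_Ad (hH : ContMDiff (𝓡 p) (𝓡 n) ∞ (Subtype.val : H → G))
    (hB : IsInvariantInnerProduct H B)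
    (hA : IsOrthonormalBasisOf B (subLie n p H) fun k => inclLie n p H (A k)) (h : H) :
    IsOrthonormalBasisOf B (subLie n p H) fun k => inclLie n p H (Ad p h (A k)) := by
  have horth : IsOrthonormalFamily B fun k => inclLie n p H (Ad p h (A k)) := fun i j => by
    simpa only [← Ad_inclLie hH, hB.invariant _ h.2] using hA.orthonormal i j
  refine ⟨horth, Submodule.eq_of_le_of_finrank_eq ?_ ?_⟩
  · rw [Submodule.span_le]
    rintro _ ⟨k, rfl⟩
    exact ⟨_, rfl⟩
  · rw [horth.finrank_span, ← hA.span_eq, IsOrthonormalFamily.finrank_span hA.orthonormal]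

theorem bilin_casimir_Ad (hH : ContMDiff (𝓡 p) (𝓡 n) ∞ (Subtype.val : H → G))
    (hB : IsInvariantInnerProduct H B)
    (hA : IsOrthonormalBasisOf B (subLie n p H) fun k => inclLie n p H (A k)) (h : H)
    (X Y : GroupLieAlgebra (𝓡 n) G) :
    B (casimir (fun k => inclLie n p H (A k)) (Ad n (h : G) X)) (Ad n (h : G) Y)
      = B (casimir (fun k => inclLie n p H (A k)) X) Y := by
  have hskew k := (hasDifferential_subgroupAdRep hH).apply_eq_neg_of_invariant
    hB.apply_subgroupAdRep (A k)
  have hA' := isOrthonormalBasisOf_inclLie_Ad hH hB hA h⁻¹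
  have lie_Ad k X : ⁅inclLie n p H (A k), Ad n (h : G) X⁆
      = Ad n (h : G) ⁅inclLie n p H (Ad p h⁻¹ (A k)), X⁆ := by
    rw [Ad_lie, ← Ad_inclLie hH]
    exact congrArg (⁅·, _⁆) ((subgroupAdRep n H).self_inv_apply h _).symm
  let T := B.comp (LieAlgebra.ad ℝ _ X) (LieAlgebra.ad ℝ _ Y)
  have hT U : B ⁅U, X⁆ ⁅U, Y⁆ = T U U := by
    rw [← lie_skew U X, ← lie_skew U Y]
    simp only [map_neg, LinearMap.neg_apply, neg_neg]
    rfl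
  simp only [casimir_inclLie, apply_casimirOperator_of_skew hskew, subLieAd_apply, lie_Ad,
    hB.invariant _ h.2, hT]
  rw [IsOrthonormalFamily.sum_apply_self_eq hB.symm hA.orthonormal hA'.orthonormal
    (hA.span_eq.trans hA'.span_eq.symm)]

/-- The Casimir operator is symmetric, and invariant because it does not depend on the
orthonormal basis of `𝔥`; so Schur's lemma applies. -/
theorem exists_casimir_eq_smul (hH : ContMDiff (𝓡 p) (𝓡 n) ∞ (Subtype.val : H → G))
    (hB : IsInvariantInnerProduct H B)
    (hA : IsOrthonormalBasisOf B (subLie n p H) fun k => inclLie n p H (A k))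
    (hU : IsAdIrreducible H U) (hW : IsOrthonormalBasisOf B U W) :
    ∃ κ : ℝ, ∀ X ∈ U, casimir (fun k => inclLie n p H (A k)) X = κ • X := by
  have hskew k := (hasDifferential_subgroupAdRep hH).apply_eq_neg_of_invariant
    hB.apply_subgroupAdRep (A k)
  have hmem X (hX : X ∈ U) := casimir_mem (A := A) hH hU.invariant hX
  have hinv h X Y := bilin_casimir_Ad hH hB hA h X Y
  simp only [casimir_inclLie] at hmem hinv ⊢
  refine hU.isIrreducibleSubspace.exists_apply_eq_smul hB.apply_subgroupAdRep hB.pos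
    hW.orthonormal hW.span_eq hmem (fun X _ X' _ => ?_) fun h X _ X' _ => hinv h X X'
  simp only [apply_casimirOperator_of_skew hskew, hB.symm (subLieAd n _ X')]

variable [CompactSpace H] [MeasurableSpace H] [BorelSpace H] (μ : Measure H) [μ.IsHaarMeasure]
  [IsProbabilityMeasure μ]

theorem neg_integral_coeff_mul (hH : ContMDiff (𝓡 p) (𝓡 n) ∞ (Subtype.val : H → G))
    (hB : IsInvariantInnerProduct H B) (hU : IsAdIrreducible H U) (hW : IsOrthonormalBasisOf B U W)
    {X : GroupLieAlgebra (𝓡 n) G} (hX : X ∈ U) {Y₀ : GroupLieAlgebra (𝓡 n) G}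
    (hXY : casimir (fun k => inclLie n p H (A k)) X = Y₀) (Z : GroupLieAlgebra (𝓡 n) G)
    {Z' : GroupLieAlgebra (𝓡 n) G} {β : H → ℝ} (hβ : IsPoissonSolution H A (coeff H B Y₀ Z') β) :
    -∫ h, coeff H B Y₀ Z h * β h ∂μ
      = B X Y₀ / Module.finrank ℝ U * ∑ m, B (W m) Z * B (W m) Z' := by
  have : IsTopologicalGroup H := topologicalGroup_of_lieGroup (𝓡 p) ∞
  have hσ := hasDifferential_subgroupAdRep hH
  have hY₀ : Y₀ ∈ U := hXY ▸ casimir_mem hH hU.invariant hX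
  rw [casimir_inclLie] at hXY
  subst hXY
  exact (hσ.neg_integral_matrixCoeff_mul μ
    (hβ.smooth.of_le (WithTop.coe_le_coe.mpr le_top)) hβ.eq).trans
    (hU.isIrreducibleSubspace.correlation_apply_eq hB.apply_subgroupAdRep hB.symm hW.orthonormal
      hW.span_eq hX hY₀ (hσ.correlation_casimirOperator_comm μ A X) Z Z')

variable {q : ℕ} {Z : Fin q → GroupLieAlgebra (𝓡 n) G} {Y₀ : GroupLieAlgebra (𝓡 n) G}
  {β : Fin q → H → ℝ} {f : G → ℝ}

theorem effectiveGenerator_eq (hH : ContMDiff (𝓡 p) (𝓡 n) ∞ (Subtype.val : H → G))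
    (hB : IsInvariantInnerProduct H B) (hU : IsAdIrreducible H U) (hW : IsOrthonormalBasisOf B U W)
    (hZ : IsOrthonormalFamily B Z) (hUZ : U ≤ Submodule.span ℝ (Set.range Z))
    {X : GroupLieAlgebra (𝓡 n) G} (hX : X ∈ U) (hXY : casimir (fun k => inclLie n p H (A k)) X = Y₀)
    (hβ : ∀ j, IsPoissonSolution H A (coeff H B Y₀ (Z j)) (β j))
    (hf : ContMDiff (𝓡 n) 𝓘(ℝ, ℝ) 2 f) (g : G) :
    effectiveGenerator H μ B Y₀ Z β f g = B X Y₀ / Module.finrank ℝ U * sumSquares W f g := by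
  have hWZ m : W m ∈ Submodule.span ℝ (Set.range Z) := hUZ (hW.mem m)
  simp only [effectiveGenerator, sumSquares_eq_of_orthonormal hZ hWZ hf, Finset.mul_sum,
    ← mul_assoc, neg_integral_coeff_mul μ hH hB hU hW hX hXY _ (hβ _)]

theorem effectiveGenerator_eq_of_casimir_eq_smul
    (hH : ContMDiff (𝓡 p) (𝓡 n) ∞ (Subtype.val : H → G)) (hB : IsInvariantInnerProduct H B)
    (hU : IsAdIrreducible H U) (hW : IsOrthonormalBasisOf B U W) (hZ : IsOrthonormalFamily B Z)
    (hUZ : U ≤ Submodule.span ℝ (Set.range Z)) (hY₀ : Y₀ ∈ U) {κ : ℝ} (hκ : κ ≠ 0)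
    (hC : casimir (fun k => inclLie n p H (A k)) Y₀ = κ • Y₀)
    (hβ : ∀ j, IsPoissonSolution H A (coeff H B Y₀ (Z j)) (β j))
    (hf : ContMDiff (𝓡 n) 𝓘(ℝ, ℝ) 2 f) (g : G) :
    effectiveGenerator H μ B Y₀ Z β f g
      = B Y₀ Y₀ / (Module.finrank ℝ U * κ) * sumSquares W f g := by
  have hX : casimir (fun k => inclLie n p H (A k)) (κ⁻¹ • Y₀) = Y₀ := by
    rw [casimir_inclLie, map_smul, ← casimir_inclLie, hC, inv_smul_smul₀ hκ]
  rw [effectiveGenerator_eq μ hH hB hU hW hZ hUZ (U.smul_mem κ⁻¹ hY₀) hX hβ hf,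
    LinearMap.map_smul₂, smul_eq_mul]
  field_simp

theorem effectiveGenerator_eq_of_eigenbasis
    (hH : ContMDiff (𝓡 p) (𝓡 n) ∞ (Subtype.val : H → G)) (hB : IsInvariantInnerProduct H B)
    (hU : IsAdIrreducible H U) (hW : IsOrthonormalBasisOf B U W) (hZ : IsOrthonormalFamily B Z)
    (hUZ : U ≤ Submodule.span ℝ (Set.range Z)) {d' : ℕ} {Y : Fin d' → GroupLieAlgebra (𝓡 n) G}
    {lam c : Fin d' → ℝ} (hY : IsOrthonormalBasisOf B U Y) (hlam : ∀ m, lam m ≠ 0)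
    (hC : ∀ m, casimir (fun k => inclLie n p H (A k)) (Y m) = lam m • Y m)
    (hY₀ : Y₀ = ∑ m, c m • Y m) (hβ : ∀ j, IsPoissonSolution H A (coeff H B Y₀ (Z j)) (β j))
    (hf : ContMDiff (𝓡 n) 𝓘(ℝ, ℝ) 2 f) (g : G) :
    effectiveGenerator H μ B Y₀ Z β f g
      = (1 / (Module.finrank ℝ U : ℝ)) * (∑ m, c m ^ 2 / lam m) * sumSquares W f g := by
  simp only [casimir_inclLie] at hC
  have hX : casimir (fun k => inclLie n p H (A k)) (∑ m, (c m / lam m) • Y m) = Y₀ := by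
    rw [casimir_inclLie, apply_sum_div_smul_of_apply_eq_smul _ hlam hC, hY₀]
  have hXY₀ : B (∑ m, (c m / lam m) • Y m) Y₀ = ∑ m, c m ^ 2 / lam m := by
    rw [hY₀, IsOrthonormalFamily.apply_sum_sum hY.orthonormal]
    exact Finset.sum_congr rfl fun m _ => by ring
  rw [effectiveGenerator_eq μ hH hB hU hW hZ hUZ (U.sum_mem fun m _ => U.smul_mem _ (hY.mem m))
    hX hβ hf, hXY₀, div_eq_inv_mul, one_div]

end Subgroup

end EffectiveLimit

open EffectiveLimit in
theorem mainTheorem3_general {n p : ℕ} {G : Type*} [TopologicalSpace G] [Group G]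
    [ChartedSpace (EuclideanSpace ℝ (Fin n)) G] [LieGroup (𝓡 n) ∞ G]
    (H : Subgroup G) [ChartedSpace (EuclideanSpace ℝ (Fin p)) H] [LieGroup (𝓡 p) ∞ H]
    (hH : ContMDiff (𝓡 p) (𝓡 n) ∞ (Subtype.val : H → G)) [CompactSpace H] [PreconnectedSpace H]
    [MeasurableSpace H] [BorelSpace H] (μ : Measure H) [μ.IsHaarMeasure] [IsProbabilityMeasure μ]
    (B : LinearMap.BilinForm ℝ (GroupLieAlgebra (𝓡 n) G)) (hB : IsInvariantInnerProduct H B)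
    {N : ℕ} (A : Fin N → GroupLieAlgebra (𝓡 p) H) (hA : IsLieGenerating (n := n) H A)
    (U : Submodule ℝ (GroupLieAlgebra (𝓡 n) G)) (hU : IsAdIrreducible H U)
    (hfix : ∀ X ∈ U, (∀ h ∈ H, Ad n h X = X) → X = 0)
    (Y₀ : GroupLieAlgebra (𝓡 n) G) (hY₀ : Y₀ ∈ U)
    {q : ℕ} (Z : Fin q → GroupLieAlgebra (𝓡 n) G) (hZ : IsOrthonormalFamily B Z)
    (hUZ : U ≤ Submodule.span ℝ (Set.range Z))
    {d : ℕ} (W : Fin d → GroupLieAlgebra (𝓡 n) G) (hW : IsOrthonormalBasisOf B U W) :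
    (∀ j, ∃ u, IsPoissonSolution H A (coeff H B Y₀ (Z j)) u) ∧
    ∀ β : Fin q → H → ℝ, (∀ j, IsPoissonSolution H A (coeff H B Y₀ (Z j)) (β j)) →
      (∀ (Y : Fin d → GroupLieAlgebra (𝓡 n) G) (lam c : Fin d → ℝ), IsOrthonormalBasisOf B U Y →
        (∀ m, casimir (fun k => inclLie n p H (A k)) (Y m) = lam m • Y m) →
        Y₀ = ∑ m, c m • Y m →
        (∀ m, 0 < lam m) ∧
        ∀ f : G → ℝ, ContMDiff (𝓡 n) 𝓘(ℝ, ℝ) 2 f → ∀ g,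
          effectiveGenerator H μ B Y₀ Z β f g =
            (1 / (Module.finrank ℝ U : ℝ)) * (∑ m, c m ^ 2 / lam m) * sumSquares W f g) ∧
      (IsOrthonormalBasisOf B (subLie n p H) (fun k => inclLie n p H (A k)) →
        ∃ laml : ℝ, 0 < laml ∧
          (∀ X ∈ U, casimir (fun k => inclLie n p H (A k)) X = laml • X) ∧
          ∀ f : G → ℝ, ContMDiff (𝓡 n) 𝓘(ℝ, ℝ) 2 f → ∀ g,
            effectiveGenerator H μ B Y₀ Z β f g =
              B Y₀ Y₀ / ((Module.finrank ℝ U : ℝ) * laml) * sumSquares W f g) := by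
  have hmoves X (hX : X ∈ U) (hne : X ≠ 0) : ¬∀ h ∈ H, Ad n h X = X := mt (hfix X hX) hne
  obtain ⟨X, -, rfl⟩ := exists_casimir_eq hH hU.invariant
    (fun X hX hne => bilin_casimir_self_pos hH hB hA (hmoves X hX hne)) hY₀
  refine ⟨fun j => ⟨_, isPoissonSolution_neg_coeff hH X (Z j)⟩, fun β hβ => ⟨?_, fun hA_orth => ?_⟩⟩
  · intro Y lam c hY hlam hc
    have hY_ne m : Y m ≠ 0 := (IsOrthonormalFamily.linearIndependent hY.orthonormal).ne_zero m
    have hpos m : 0 < lam m :=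
      pos_of_casimir_eq_smul hH hB hA (hmoves _ (hY.mem m) (hY_ne m)) (hlam m)
    exact ⟨hpos, fun f hf => effectiveGenerator_eq_of_eigenbasis μ hH hB hU hW hZ hUZ hY
      (fun m => (hpos m).ne') hlam hc hβ hf⟩
  · obtain ⟨κ, hκ⟩ := exists_casimir_eq_smul hH hB hA_orth hU hW
    obtain ⟨X₁, hX₁, hne⟩ := U.ne_bot_iff.1 hU.ne_bot
    have hpos : 0 < κ := pos_of_casimir_eq_smul hH hB hA (hmoves X₁ hX₁ hne) (hκ X₁ hX₁)
    exact ⟨κ, hpos, hκ, fun f hf => effectiveGenerator_eq_of_casimir_eq_smul μ hH hB hU hW hZ hUZ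
      hY₀ hpos.ne' (hκ _ hY₀) hβ hf⟩

theorem mainTheorem3 {n p : ℕ} {G : Type*} [TopologicalSpace G] [T2Space G] [Group G]
    [ChartedSpace (EuclideanSpace ℝ (Fin n)) G] [LieGroup (𝓡 n) ∞ G]
    -- `H` is a compact connected (embedded) Lie subgroup of `G`
    (H : Subgroup G) [ChartedSpace (EuclideanSpace ℝ (Fin p)) H] [LieGroup (𝓡 p) ∞ H]
    (_hH : Manifold.IsSmoothEmbedding (𝓡 p) (𝓡 n) ∞ (Subtype.val : H → G))
    [CompactSpace H] [ConnectedSpace H]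
    -- `μ` is the normalised Haar measure of `H`
    [MeasurableSpace H] [BorelSpace H] (μ : Measure H) [μ.IsHaarMeasure] [IsProbabilityMeasure μ]
    -- an `Ad H`-invariant inner product and the decomposition `𝔪 = 𝔪₀ ⊕ ⋯ ⊕ 𝔪ᵣ`
    (B : LinearMap.BilinForm ℝ (GroupLieAlgebra (𝓡 n) G))
    (_hB : EffectiveLimit.IsInvariantInnerProduct H B)
    {r : ℕ} (𝔪 : Fin (r + 1) → Submodule ℝ (GroupLieAlgebra (𝓡 n) G))
    (_h𝔪 : EffectiveLimit.IsIrreducibleDecomposition p H B 𝔪)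
    -- Lie algebra generating elements of `𝔥`
    {N : ℕ} (A : Fin N → GroupLieAlgebra (𝓡 p) H)
    (_hA : EffectiveLimit.IsLieGenerating (n := n) H A)
    -- `Y₀ ∈ 𝔪ₗ` with `l ≠ 0`
    (l : Fin (r + 1)) (_hl : l ≠ 0) (Y₀ : GroupLieAlgebra (𝓡 n) G) (_hY₀ : Y₀ ∈ 𝔪 l)
    -- an orthonormal basis `Z` of an invariant subspace `V` with `𝔪ₗ ⊆ V ⊆ 𝔪`
    (V : Submodule ℝ (GroupLieAlgebra (𝓡 n) G)) (_hV : EffectiveLimit.IsAdInvariant H V)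
    (_hlV : 𝔪 l ≤ V) (_hVm : V ≤ EffectiveLimit.compl p H B)
    {q : ℕ} (Z : Fin q → GroupLieAlgebra (𝓡 n) G)
    (_hZ : EffectiveLimit.IsOrthonormalBasisOf B V Z)
    -- an orthonormal basis `W` of `𝔪ₗ`, so that `sumSquares W` is `Δ_{𝔪ₗ}`
    {d : ℕ} (W : Fin d → GroupLieAlgebra (𝓡 n) G)
    (_hW : EffectiveLimit.IsOrthonormalBasisOf B (𝔪 l) W) :
    -- the Poisson equations that define the effective generator are solvable
    (∀ j, ∃ u, EffectiveLimit.IsPoissonSolution H A (EffectiveLimit.coeff H B Y₀ (Z j)) u) ∧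
    -- and, for any choice of their solutions:
    ∀ β : Fin q → H → ℝ,
      (∀ j, EffectiveLimit.IsPoissonSolution H A (EffectiveLimit.coeff H B Y₀ (Z j)) (β j)) →
      (∀ (Y : Fin d → GroupLieAlgebra (𝓡 n) G) (lam c : Fin d → ℝ),
        EffectiveLimit.IsOrthonormalBasisOf B (𝔪 l) Y →
        (∀ m, EffectiveLimit.casimir (fun k => EffectiveLimit.inclLie n p H (A k)) (Y m)
          = lam m • Y m) →
        Y₀ = ∑ m, c m • Y m →
        (∀ m, 0 < lam m) ∧
        ∀ f : G → ℝ, ContMDiff (𝓡 n) 𝓘(ℝ, ℝ) 2 f → ∀ g,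
          EffectiveLimit.effectiveGenerator H μ B Y₀ Z β f g =
            (1 / (Module.finrank ℝ (𝔪 l) : ℝ)) * (∑ m, c m ^ 2 / lam m) *
              EffectiveLimit.sumSquares W f g) ∧
      (EffectiveLimit.IsOrthonormalBasisOf B (EffectiveLimit.subLie n p H)
          (fun k => EffectiveLimit.inclLie n p H (A k)) →
        ∃ laml : ℝ, 0 < laml ∧
          (∀ X ∈ 𝔪 l, EffectiveLimit.casimir (fun k => EffectiveLimit.inclLie n p H (A k)) X
            = laml • X) ∧
          ∀ f : G → ℝ, ContMDiff (𝓡 n) 𝓘(ℝ, ℝ) 2 f → ∀ g,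
            EffectiveLimit.effectiveGenerator H μ B Y₀ Z β f g =
              B Y₀ Y₀ / ((Module.finrank ℝ (𝔪 l) : ℝ) * laml) *
                EffectiveLimit.sumSquares W f g) := by
  exact mainTheorem3_general H _hH.contMDiff μ B _hB A _hA (𝔪 l) (_h𝔪.irreducible l _hl)
    (fun _ => _h𝔪.eq_zero_of_forall_Ad_eq_self _hB.pos _hl) Y₀ _hY₀ Z _hZ.orthonormal
    (_hlV.trans_eq _hZ.span_eq.symm) W _hW
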